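/- For $\alpha\in(0,1)$ and an integer $m\ge 0$, let $N_\alpha(m)$ denote the maximum number of lines through the origin in $\mathbb{R}^m$ such that any two distinct ones meet at the angle $\arccos\alpha$. The eigenvalues of a graph are the eigenvalues of its adjacency matrix, listed in decreasing order with multiplicity; the second eigenvalue is the second entry of this list. Let $G$ be a connected $d$-regular (finite, simple) graph on $n$ vertices whose second eigenvalue $\lambda$ is positive and has multiplicity $k$ as an eigenvalue of $G$, and let $\alpha=\frac{1}{2\lambda+1}$. (a) If $n\ge 2d$, then $N_\alpha(n-k)\ge n$. (b) If $n\ge 2d$, $\lambda\ge 2\sqrt{d-1}$ and $\lambda\ge \frac{2d}{3}$, then $N_\alpha(m)\ge m+k$ for every integer $m\ge n-k$. -/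

import Mathlib

/-- `lam` is the second eigenvalue of the graph `G`: the entry at position `2` in the list of
the eigenvalues of its (real) adjacency matrix in decreasing order, counted with multiplicity.
Such an entry exists only if `G` has at least two vertices. -/
def IsSecondEigenvalue {V : Type*} [Fintype V] [DecidableEq V] (G : SimpleGraph V)
    [DecidableRel G.Adj] (lam : ℝ) : Prop :=
  ∃ hV : 1 < Fintype.card V, (G.isHermitian_adjMatrix ℝ).eigenvalues₀ ⟨1, hV⟩ = lam

/-- The multiplicity of `lam` as an eigenvalue of the adjacency matrix of `G`. -/
noncomputable def eigenvalueMultiplicity {V : Type*} [Fintype V] [DecidableEq V]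
    (G : SimpleGraph V) [DecidableRel G.Adj] (lam : ℝ) : ℕ :=
  Module.finrank ℝ (Module.End.eigenspace (Matrix.toLin' (G.adjMatrix ℝ)) lam)

/-- Two lines through the origin meet at the angle `θ` (an angle in `[0, π / 2]`): some nonzero
vectors on them make this angle. -/
def LinesMeetAtAngle {m : ℕ} (l₁ l₂ : Submodule ℝ (EuclideanSpace ℝ (Fin m))) (θ : ℝ) : Prop :=
  ∃ u ∈ l₁, ∃ v ∈ l₂, u ≠ 0 ∧ v ≠ 0 ∧ θ ≤ Real.pi / 2 ∧ InnerProductGeometry.angle u v = θ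

/-- A set of lines through the origin of `ℝ^m`, any two distinct ones of which meet at the
angle `arccos α`. -/
def IsEquiangularLines (α : ℝ) {m : ℕ} (L : Set (Submodule ℝ (EuclideanSpace ℝ (Fin m)))) :
    Prop :=
  (∀ l ∈ L, Module.finrank ℝ l = 1) ∧
    L.Pairwise fun l₁ l₂ => LinesMeetAtAngle l₁ l₂ (Real.arccos α)

/-- `N_α(m)`: the maximum number of lines in `ℝ^m` that pairwise meet at the angle `arccos α`,
as the supremum in `ℕ∞` of the sizes of such sets of lines. -/
noncomputable def maxEquiangularLines (α : ℝ) (m : ℕ) : ℕ∞ :=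
  ⨆ (L : Set (Submodule ℝ (EuclideanSpace ℝ (Fin m)))) (_ : IsEquiangularLines α L), L.encard

/-! Let `A` be the adjacency matrix. The matrix `2α(λI - A + J/2)` has diagonal `1` and off-diagonal
entries `±α`, so if it is positive semidefinite it is the Gram matrix of equiangular unit vectors in
a space whose dimension is its rank. It is nonnegative on sum-zero vectors by the choice of `λ`, and
on constants because `n ≥ 2d`. The `λ`-eigenspace lies in its kernel, so the rank is at most `n -
k`: this is (a).

For (b), add `t ≤ n` isolated vertices; `λ ≥ 2d/3` keeps the matrix semidefinite and the rank is at
most `n + t - k`. This reaches `m + k ≤ 2n`. Beyond that, replace the graph by a 2-lift, whose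
spectrum is that of `A` together with that of a signing of `A`. If the signing has largest
eigenvalue at most `2√(d - 1) ≤ λ`, all that was used survives and `n` doubles.

Such a signing exists by Marcus, Spielman and Srivastava. The characteristic polynomials of all
signings sum to a multiple of the matching polynomial, which is positive beyond `2√(d - 1)`
(Heilmann and Lieb). As `d + A_ε` is a sum of rank-one matrices, one per edge, the signs can be
fixed one edge at a time while keeping the partial sum positive there
(`exists_det_pos_of_sumDet_pos`). -/

section

/-! ### Determinants under rank-one updates, summed over choices -/

open Matrix

/-- By the Schur complement this is the determinant of a bordered matrix in which `t` enters one row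
only, hence it is affine in `t`. -/
theorem Matrix.det_add_smul_vecMulVec {V R : Type*} [Fintype V] [DecidableEq V] [CommRing R]
    (A : Matrix V V R) (u w : V → R) (t : R) :
    (A + t • vecMulVec u w).det = A.det + t * ((A + vecMulVec u w).det - A.det) := by
  have key : ∃ a b : R, ∀ t : R, (A + t • vecMulVec u w).det = a + t * b := by
    let Q : Matrix (V ⊕ Unit) (V ⊕ Unit) R :=
      fromBlocks A (replicateCol Unit u) (replicateRow Unit 0) 1
    have hQ : ∀ t : R, (A + t • vecMulVec u w).det =
        (Q.updateRow (Sum.inr ())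
          (Sum.elim (0 : V → R) (1 : Unit → R) + t • Sum.elim (-w) (0 : Unit → R))).det := by
      intro t
      have : Q.updateRow (Sum.inr ())
          (Sum.elim (0 : V → R) (1 : Unit → R) + t • Sum.elim (-w) (0 : Unit → R)) =
          fromBlocks A (replicateCol Unit u) (replicateRow Unit (t • -w)) 1 := by
        ext i j
        rcases i with i | i <;> rcases j with j | j <;> simp [Q, updateRow_apply]
      rw [this, det_fromBlocks_one₂₂]
      congr 1
      ext i j
      simp [vecMulVec_apply, mul_apply]
      ring
    refine ⟨(Q.updateRow (Sum.inr ()) (Sum.elim (0 : V → R) (1 : Unit → R))).det,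
      (Q.updateRow (Sum.inr ()) (Sum.elim (-w) (0 : Unit → R))).det, fun t => ?_⟩
    rw [hQ, det_updateRow_add, det_updateRow_smul]
  obtain ⟨a, b, h⟩ := key
  have h0 := h 0
  have h1 := h 1
  simp only [zero_smul, add_zero, zero_mul, one_smul, one_mul] at h0 h1
  rw [h, h0, h1]
  ring

/-- The sum of the determinants `det (M - ∑ i, vᵢ vᵢᵀ)` over all choices of one vector `vᵢ` out of
each of the pairs `v i`. -/
def sumDet {V R ι : Type*} [Fintype V] [DecidableEq V] [CommRing R] [Fintype ι] [DecidableEq ι]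
    (v : ι → Bool → V → R) (M : Matrix V V R) : R :=
  ∑ ε : ι → Bool, (M - ∑ i, vecMulVec (v i (ε i)) (v i (ε i))).det

section
variable {V R : Type*} [Fintype V] [DecidableEq V] [CommRing R]

theorem sumDet_zero (v : Fin 0 → Bool → V → R) (M : Matrix V V R) : sumDet v M = M.det := by
  simp [sumDet]

theorem sumDet_succ {m : ℕ} (v : Fin (m + 1) → Bool → V → R) (M : Matrix V V R) :
    sumDet v M = sumDet (fun i : Fin m => v i.succ) (M - vecMulVec (v 0 true) (v 0 true)) +
      sumDet (fun i : Fin m => v i.succ) (M - vecMulVec (v 0 false) (v 0 false)) := by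
  unfold sumDet
  rw [← (Fin.consEquiv fun _ => Bool).sum_comp, Fintype.sum_prod_type, Fintype.sum_bool]
  simp [Fin.consEquiv, Fin.sum_univ_succ, sub_sub]

theorem sumDet_add_smul {ι : Type*} [Fintype ι] [DecidableEq ι] (v : ι → Bool → V → R)
    (M : Matrix V V R) (u : V → R) (t : R) :
    sumDet v (M + t • vecMulVec u u) =
      sumDet v M + t * (sumDet v M - sumDet v (M - vecMulVec u u)) := by
  have h : ∀ t, sumDet v (M + t • vecMulVec u u) =
      sumDet v M + t * (sumDet v (M + vecMulVec u u) - sumDet v M) := by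
    intro t
    simp only [sumDet, ← Finset.sum_sub_distrib, Finset.mul_sum, ← Finset.sum_add_distrib]
    refine Finset.sum_congr rfl fun ε _ => ?_
    rw [add_sub_right_comm, det_add_smul_vecMulVec, add_sub_right_comm]
  have h1 := h (-1)
  rw [neg_one_smul, ← sub_eq_add_neg] at h1
  rw [h, h1]
  ring

theorem map_sumDet {S ι : Type*} [CommRing S] [Fintype ι] [DecidableEq ι] (f : R →+* S)
    (v : ι → Bool → V → R) (M : Matrix V V R) :
    f (sumDet v M) = sumDet (fun i b => f ∘ v i b) (M.map f) := by
  simp only [sumDet, map_sum, RingHom.map_det]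
  refine Finset.sum_congr rfl fun ε _ => congrArg det ?_
  ext i j
  simp [vecMulVec_apply, Matrix.sum_apply]

theorem sumDet_reindex {ι κ : Type*} [Fintype ι] [DecidableEq ι] [Fintype κ] [DecidableEq κ]
    (e : κ ≃ ι) (v : ι → Bool → V → R) (M : Matrix V V R) :
    sumDet (fun i => v (e i)) M = sumDet v M := by
  unfold sumDet
  rw [← (Equiv.arrowCongr e (Equiv.refl Bool)).sum_comp]
  refine Finset.sum_congr rfl fun ε _ => ?_
  rw [← e.sum_comp]
  simp

end

/-! ### Zero-freeness on the upper half plane -/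

section
variable {V : Type*} [Fintype V] [DecidableEq V]

/-- The imaginary part of the complex matrix `M` is positive definite. -/
def Matrix.ImPosDef (M : Matrix V V ℂ) : Prop :=
  ∀ x : V → ℂ, x ≠ 0 → 0 < (star x ⬝ᵥ M *ᵥ x).im

theorem Matrix.ImPosDef.det_ne_zero {M : Matrix V V ℂ} (hM : M.ImPosDef) : M.det ≠ 0 := by
  intro h
  obtain ⟨x, hx, hMx⟩ := exists_mulVec_eq_zero_iff.2 h
  simpa [hMx] using hM x hx

theorem star_dotProduct_vecMulVec_mulVec {V : Type*} [Fintype V] (u : V → ℝ) (x : V → ℂ) :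
    star x ⬝ᵥ vecMulVec ((↑) ∘ u) ((↑) ∘ u) *ᵥ x =
      (Complex.normSq (((↑) ∘ u : V → ℂ) ⬝ᵥ x) : ℂ) := by
  rw [vecMulVec_mulVec, dotProduct_comm (star x), Complex.normSq_eq_conj_mul_self]
  have : (starRingEnd ℂ) (((↑) ∘ u : V → ℂ) ⬝ᵥ x) = ((↑) ∘ u : V → ℂ) ⬝ᵥ star x := by
    simp [dotProduct]
  rw [this]
  simp only [dotProduct, Finset.sum_mul]
  refine Finset.sum_congr rfl fun i _ => ?_
  simp
  ring

theorem Matrix.ImPosDef.add_smul {V : Type*} [Fintype V] {M : Matrix V V ℂ}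
    (hM : M.ImPosDef) (u : V → ℝ) {t : ℂ} (ht : 0 ≤ t.im) :
    (M + t • vecMulVec ((↑) ∘ u : V → ℂ) ((↑) ∘ u)).ImPosDef := by
  intro x hx
  rw [add_mulVec, dotProduct_add, smul_mulVec, dotProduct_smul, star_dotProduct_vecMulVec_mulVec]
  simp only [smul_eq_mul, Complex.add_im, Complex.im_mul_ofReal]
  have := hM x hx
  have := mul_nonneg ht (Complex.normSq_nonneg (((↑) ∘ u : V → ℂ) ⬝ᵥ x))
  linarith

/-- The only root `t = -a / b` must lie in the open lower half plane, and its imaginary part has the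
sign of that of `b / a`. -/
theorem im_div_neg_of_forall_ne_zero {a b : ℂ} (h : ∀ t : ℂ, 0 ≤ t.im → a + t * b ≠ 0)
    (hb : b ≠ 0) : (b / a).im < 0 := by
  by_contra! hc
  have ha : a ≠ 0 := by simpa using h 0 (by simp)
  refine h (-(a / b)) ?_ (by field_simp; ring)
  have : -(a / b) = -(b / a)⁻¹ := by simp
  rw [this, Complex.neg_im, Complex.inv_im, neg_div, neg_neg]
  exact div_nonneg hc (Complex.normSq_nonneg _)

/-- Induction on the number of pairs. With `F` the sum over the remaining pairs, a zero forces `D1 /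
F + D2 / F = 2`. But `F` has no zero along `M + t u uᵀ` with `0 ≤ t.im`, so each nonzero `D / F` has
negative imaginary part; and both cannot vanish. -/
theorem sumDet_ne_zero {m : ℕ} (v : Fin m → Bool → V → ℝ) {M : Matrix V V ℂ} (hM : M.ImPosDef) :
    sumDet (fun i b => ((↑) ∘ v i b : V → ℂ)) M ≠ 0 := by
  induction m generalizing M with
  | zero => rw [sumDet_zero]; exact hM.det_ne_zero
  | succ m ih =>
    rw [sumDet_succ]
    set F := sumDet (fun (i : Fin m) b => ((↑) ∘ v i.succ b : V → ℂ)) with hF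
    have hFne : F M ≠ 0 := ih _ hM
    have key : ∀ b, F M - F (M - vecMulVec ((↑) ∘ v 0 b) ((↑) ∘ v 0 b)) ≠ 0 →
        ((F M - F (M - vecMulVec ((↑) ∘ v 0 b) ((↑) ∘ v 0 b))) / F M).im < 0 := by
      intro b
      refine im_div_neg_of_forall_ne_zero fun t ht => ?_
      rw [← sumDet_add_smul]
      exact ih _ (hM.add_smul _ ht)
    intro h0
    have hk1 := key true
    have hk2 := key false
    set D1 := F M - F (M - vecMulVec ((↑) ∘ v 0 true) ((↑) ∘ v 0 true)) with hD1
    set D2 := F M - F (M - vecMulVec ((↑) ∘ v 0 false) ((↑) ∘ v 0 false)) with hD2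
    have hsum : D1 + D2 = 2 * F M := by
      rw [hD1, hD2]; linear_combination -h0
    have him : (D1 / F M).im + (D2 / F M).im = 0 := by
      rw [← Complex.add_im, ← add_div, hsum, mul_div_cancel_right₀ _ hFne]
      simp
    by_cases h1 : D1 = 0 <;> by_cases h2 : D2 = 0
    · rw [h1, h2] at hsum
      simp [hFne] at hsum
    · have := hk2 h2
      simp [h1] at him; linarith
    · have := hk1 h1
      simp [h2] at him; linarith
    · linarith [hk1 h1, hk2 h2]

theorem im_sumDet_div_nonpos {m : ℕ} (v : Fin m → Bool → V → ℝ) (u : V → ℝ) {M : Matrix V V ℂ}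
    (hM : M.ImPosDef) :
    ((sumDet (fun i b => ((↑) ∘ v i b : V → ℂ)) M -
      sumDet (fun i b => ((↑) ∘ v i b : V → ℂ)) (M - vecMulVec ((↑) ∘ u) ((↑) ∘ u))) /
      sumDet (fun i b => ((↑) ∘ v i b : V → ℂ)) M).im ≤ 0 := by
  by_cases hb : sumDet (fun i b => ((↑) ∘ v i b : V → ℂ)) M -
      sumDet (fun i b => ((↑) ∘ v i b : V → ℂ)) (M - vecMulVec ((↑) ∘ u) ((↑) ∘ u)) = 0
  · simp [hb]
  · refine (im_div_neg_of_forall_ne_zero (fun t ht => ?_) hb).le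
    rw [← sumDet_add_smul]
    exact sumDet_ne_zero v (hM.add_smul _ ht)

theorem Matrix.IsSymm.imPosDef_add_smul_one {M : Matrix V V ℝ} (hM : M.IsSymm) {z : ℂ}
    (hz : 0 < z.im) : (M.map Complex.ofReal + z • (1 : Matrix V V ℂ)).ImPosDef := by
  intro x hx
  have h1 : (star x ⬝ᵥ (M.map Complex.ofReal) *ᵥ x).im = 0 := by
    have hH : (M.map Complex.ofReal).IsHermitian := by
      ext i j
      simp [← hM.apply i j]
    rw [← Complex.conj_eq_iff_im]
    have : (starRingEnd ℂ) (star x ⬝ᵥ (M.map Complex.ofReal) *ᵥ x) =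
        star (star x ⬝ᵥ (M.map Complex.ofReal) *ᵥ x) := rfl
    rw [this, ← star_dotProduct_star, star_star, star_mulVec, hH.eq, dotProduct_mulVec,
      dotProduct_comm]
  have h2 : star x ⬝ᵥ x = ((∑ i, Complex.normSq (x i) : ℝ) : ℂ) := by
    simp [dotProduct, Complex.normSq_eq_conj_mul_self]
  rw [add_mulVec, dotProduct_add, smul_mulVec, dotProduct_smul, one_mulVec, h2, Complex.add_im, h1,
    smul_eq_mul, Complex.im_mul_ofReal, zero_add]
  refine mul_pos hz ?_
  obtain ⟨i, hi⟩ := Function.ne_iff.1 hx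
  exact Finset.sum_pos' (fun i _ => Complex.normSq_nonneg _)
    ⟨i, Finset.mem_univ _, Complex.normSq_pos.2 hi⟩

end

/-- A function that is real on the real line and maps the upper half plane to the closed lower
half plane has a nonpositive derivative at real points. -/
theorem re_deriv_nonpos_of_im_nonpos {h : ℂ → ℂ} {c : ℂ} {s : ℝ} (hd : HasDerivAt h c s)
    (hreal : (h s).im = 0) (him : ∀ z : ℂ, 0 < z.im → (h z).im ≤ 0) : c.re ≤ 0 := by
  have h1 : HasDerivAt (fun y : ℝ => (h (s + y * Complex.I)).im) c.re 0 := by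
    have hg : HasDerivAt (fun y : ℂ => (s : ℂ) + y * Complex.I) Complex.I ((0 : ℝ) : ℂ) := by
      simpa using ((hasDerivAt_id ((0 : ℝ) : ℂ)).mul_const Complex.I).const_add (s : ℂ)
    -- The factor `-i` turns the imaginary part of `h` into a real part, which `real_of_complex` can
    -- differentiate.
    have h2 : HasDerivAt (fun y : ℂ => -Complex.I * h (s + y * Complex.I))
        (-Complex.I * (c * Complex.I)) ((0 : ℝ) : ℂ) :=
      (HasDerivAt.comp (h := fun y : ℂ => (s : ℂ) + y * Complex.I) ((0 : ℝ) : ℂ)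
        (by simpa using hd) hg).const_mul _
    have h3 := h2.real_of_complex
    have e : (-Complex.I * (c * Complex.I)) = c := by
      linear_combination (-c) * Complex.I_mul_I
    rw [e] at h3
    simpa using h3
  refine le_of_tendsto h1.tendsto_slope_zero_right ?_
  filter_upwards [self_mem_nhdsWithin] with y hy
  have hy' : (0 : ℝ) < y := hy
  have := him (s + y * Complex.I) (by simpa using hy')
  simp only [zero_add, Complex.ofReal_zero, zero_mul, add_zero, hreal, sub_zero, smul_eq_mul]
  exact mul_nonpos_of_nonneg_of_nonpos (inv_nonneg.2 hy'.le) this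

/-! ### Selecting one term without positive roots -/

section
variable {V : Type*} [Fintype V] [DecidableEq V]

theorem differentiable_sumDet {ι : Type*} [Fintype ι] [DecidableEq ι] (v : ι → Bool → V → ℂ)
    (M : Matrix V V ℂ) : Differentiable ℂ fun z : ℂ => sumDet v (M + z • 1) := by
  simp only [sumDet, det_apply]
  simp only [Matrix.sub_apply, Matrix.add_apply, Matrix.smul_apply]
  fun_prop

theorem continuous_sumDet {ι : Type*} [Fintype ι] [DecidableEq ι] (v : ι → Bool → V → ℝ)
    (M : Matrix V V ℝ) : Continuous fun s : ℝ => sumDet v (M + s • 1) := by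
  simp only [sumDet]
  fun_prop

theorem eventually_det_add_smul_one_pos (M : Matrix V V ℝ) :
    ∀ᶠ s : ℝ in Filter.atTop, 0 < (M + s • 1).det := by
  have h : ∀ s : ℝ, (M + s • 1).det = (-M).charpoly.eval s := by
    intro s
    rw [eval_charpoly, sub_neg_eq_add, add_comm, scalar_apply, smul_one_eq_diagonal]
  simp only [h]
  rcases isEmpty_or_nonempty V with hV | hV
  · simp [charpoly]
  · refine (Polynomial.tendsto_atTop_of_leadingCoeff_nonneg _ ?_ ?_).eventually_gt_atTop 0
    · rw [charpoly_degree_eq_dim]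
      exact_mod_cast Fintype.card_pos
    · rw [(charpoly_monic _).leadingCoeff]
      exact zero_le_one

theorem eventually_sumDet_pos {ι : Type*} [Fintype ι] [DecidableEq ι] (v : ι → Bool → V → ℝ)
    (M : Matrix V V ℝ) : ∀ᶠ s : ℝ in Filter.atTop, 0 < sumDet v (M + s • 1) := by
  have : ∀ ε : ι → Bool, ∀ᶠ s : ℝ in Filter.atTop,
      0 < (M + s • 1 - ∑ i, vecMulVec (v i (ε i)) (v i (ε i))).det := by
    intro ε
    filter_upwards [eventually_det_add_smul_one_pos
      (M - ∑ i, vecMulVec (v i (ε i)) (v i (ε i)))] with s hs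
    rwa [add_sub_right_comm]
  filter_upwards [Filter.eventually_all.2 this] with s hs
  exact Finset.sum_pos (fun ε _ => hs ε) Finset.univ_nonempty

/-- The ratio of the decrease of `sumDet` under a rank-one update to `sumDet` itself is antitone
along `s ↦ M + s • 1` beyond the largest zero. -/
theorem antitoneOn_sumDet_ratio {m : ℕ} (v : Fin m → Bool → V → ℝ) (u : V → ℝ)
    {M : Matrix V V ℝ} (hM : M.IsSymm) {a : ℝ} (ha : ∀ s, a < s → 0 < sumDet v (M + s • 1)) :
    AntitoneOn (fun s : ℝ => (sumDet v (M + s • 1) -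
      sumDet v (M + s • 1 - vecMulVec u u)) / sumDet v (M + s • 1)) (Set.Ioi a) := by
  set w : Fin m → Bool → V → ℂ := fun i b => ((↑) ∘ v i b : V → ℂ) with hw
  set N : Matrix V V ℂ := M.map Complex.ofReal with hN
  set U : Matrix V V ℂ := vecMulVec ((↑) ∘ u) ((↑) ∘ u) with hU
  let h : ℂ → ℂ := fun z => (sumDet w (N + z • 1) - sumDet w (N - U + z • 1)) /
    sumDet w (N + z • 1)
  have hden : ∀ s : ℝ, sumDet w (N + (s : ℂ) • 1) = (sumDet v (M + s • 1) : ℝ) := by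
    intro s
    refine Eq.trans ?_ (map_sumDet Complex.ofRealHom v _).symm
    congr 1
    ext i j
    rcases eq_or_ne i j with rfl | hij
    · simp [hN]
    · simp [hN, hij]
  have hnum : ∀ s : ℝ, sumDet w (N - U + (s : ℂ) • 1) =
      (sumDet v (M + s • 1 - vecMulVec u u) : ℝ) := by
    intro s
    refine Eq.trans ?_ (map_sumDet Complex.ofRealHom v _).symm
    congr 1
    ext i j
    rcases eq_or_ne i j with rfl | hij
    · simp [hN, hU, vecMulVec_apply]
      ring
    · simp [hN, hU, hij, vecMulVec_apply]
  have hval : ∀ s : ℝ, h s = (((sumDet v (M + s • 1) -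
      sumDet v (M + s • 1 - vecMulVec u u)) / sumDet v (M + s • 1) : ℝ) : ℂ) := by
    intro s
    simp only [h, hden, hnum]
    push_cast
    rfl
  have hder : ∀ s : ℝ, a < s → HasDerivAt h (deriv h s) s := by
    intro s hs
    refine DifferentiableAt.hasDerivAt ?_
    refine DifferentiableAt.div ?_ (differentiable_sumDet w N _) ?_
    · exact (differentiable_sumDet w N _).sub (differentiable_sumDet w (N - U) _)
    · rw [hden]
      exact_mod_cast (ha s hs).ne'
  have hderR : ∀ s : ℝ, a < s → HasDerivAt (fun s : ℝ => (sumDet v (M + s • 1) -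
      sumDet v (M + s • 1 - vecMulVec u u)) / sumDet v (M + s • 1)) (deriv h s).re s := by
    intro s hs
    have := (hder s hs).real_of_complex
    simpa only [hval, Complex.ofReal_re] using this
  refine antitoneOn_of_hasDerivWithinAt_nonpos (f' := fun s => (deriv h s).re) (convex_Ioi a)
    (fun s hs => (hderR s hs).continuousAt.continuousWithinAt) ?_ ?_
  · intro s hs
    rw [interior_Ioi] at hs
    exact (hderR s hs).hasDerivWithinAt
  · intro s hs
    rw [interior_Ioi] at hs
    refine re_deriv_nonpos_of_im_nonpos (hder s hs) ?_ ?_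
    · rw [hval, Complex.ofReal_im]
    · intro z hz
      have := im_sumDet_div_nonpos v u (hM.imPosDef_add_smul_one hz)
      simpa only [h, hw, hU, hN, sub_add_eq_add_sub] using this

/-- At a largest positive zero `a` of `F(s) = sumDet v (M + s • 1)`, the two decreases would add up
to minus a positive number. But to the right of `a` their ratios to `F` are antitone, hence bounded
below near `a`, and the limit makes their sum nonnegative. -/
theorem sumDet_pos_of_add_pos {m : ℕ} (v : Fin m → Bool → V → ℝ) (u : Bool → V → ℝ)
    {M : Matrix V V ℝ} (hM : M.IsSymm)
    (h : ∀ s : ℝ, 0 < s → 0 < sumDet v (M + s • 1 - vecMulVec (u true) (u true)) +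
      sumDet v (M + s • 1 - vecMulVec (u false) (u false))) (s : ℝ) (hs : 0 < s) :
    0 < sumDet v (M + s • 1) := by
  by_contra! hneg
  let Z : Set ℝ := {s | 0 < s ∧ sumDet v (M + s • 1) ≤ 0}
  have hZne : Z.Nonempty := ⟨s, hs, hneg⟩
  obtain ⟨B, hB⟩ := Filter.eventually_atTop.1 (eventually_sumDet_pos v M)
  have hZb : BddAbove Z := ⟨B, fun t ht => le_of_not_gt fun hBt => (hB t hBt.le).not_ge ht.2⟩
  set a := sSup Z with ha
  have hapos : 0 < a := hs.trans_le (le_csSup hZb ⟨hs, hneg⟩)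
  have hcont := continuous_sumDet v M
  have hale : sumDet v (M + a • 1) ≤ 0 :=
    closure_minimal (fun t ht => ht.2) (isClosed_Iic.preimage hcont) (csSup_mem_closure hZne hZb)
  have hgt : ∀ t, a < t → 0 < sumDet v (M + t • 1) := fun t hat => by
    by_contra! hc
    exact (le_csSup hZb ⟨hapos.trans hat, hc⟩).not_gt hat
  have hage : 0 ≤ sumDet v (M + a • 1) :=
    ge_of_tendsto (hcont.continuousAt.tendsto.mono_left nhdsWithin_le_nhds)
      (Filter.eventually_of_mem (self_mem_nhdsWithin (s := Set.Ioi a)) fun t ht => (hgt t ht).le)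
  have hazero := le_antisymm hale hage
  have hanti := fun b => antitoneOn_sumDet_ratio v (u b) hM hgt
  set D : Bool → ℝ → ℝ := fun b t => sumDet v (M + t • 1) -
    sumDet v (M + t • 1 - vecMulVec (u b) (u b)) with hD
  have hDcont : ∀ b, Continuous (D b) := by
    intro b
    refine hcont.sub ?_
    have := continuous_sumDet v (M - vecMulVec (u b) (u b))
    simpa only [sub_add_eq_add_sub] using this
  set K : ℝ := D true (a + 1) / sumDet v (M + (a + 1) • 1) +
    D false (a + 1) / sumDet v (M + (a + 1) • 1) with hK
  have hge : ∀ t ∈ Set.Ioc a (a + 1), K * sumDet v (M + t • 1) ≤ D true t + D false t := by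
    intro t ht
    have hp := hgt t ht.1
    have h1 := hanti true (Set.mem_Ioi.2 ht.1) (Set.mem_Ioi.2 (lt_add_one a)) ht.2
    have h2 := hanti false (Set.mem_Ioi.2 ht.1) (Set.mem_Ioi.2 (lt_add_one a)) ht.2
    rw [← le_div_iff₀ hp, add_div]
    exact add_le_add h1 h2
  have hlim : K * sumDet v (M + a • 1) ≤ D true a + D false a := by
    refine le_of_tendsto_of_tendsto
      (((continuous_const.mul hcont).tendsto a).mono_left (nhdsWithin_le_nhds (s := Set.Ioi a)))
      ((((hDcont true).add (hDcont false)).tendsto a).mono_left nhdsWithin_le_nhds) ?_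
    filter_upwards [Ioc_mem_nhdsGT (lt_add_one a)] with t ht using hge t ht
  have := h a hapos
  simp only [hD, hazero] at hlim
  linarith

/-- This plays the role of a common interlacing. If update `b` is nonpositive at `s₀`, its ratio is
at least `1` there, hence on all of `(0, s₀]`. Were this so for both `b`, the sum would be
nonpositive near `0`. -/
theorem exists_sumDet_sub_pos {m : ℕ} (v : Fin m → Bool → V → ℝ) (u : Bool → V → ℝ)
    {M : Matrix V V ℝ} (hM : M.IsSymm)
    (h : ∀ s : ℝ, 0 < s → 0 < sumDet v (M + s • 1 - vecMulVec (u true) (u true)) +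
      sumDet v (M + s • 1 - vecMulVec (u false) (u false))) :
    ∃ b, ∀ s : ℝ, 0 < s → 0 < sumDet v (M + s • 1 - vecMulVec (u b) (u b)) := by
  have hpos := sumDet_pos_of_add_pos v u hM h
  by_contra! hc
  have hratio : ∀ b, ∃ s₀ : ℝ, 0 < s₀ ∧ ∀ s, 0 < s → s ≤ s₀ →
      sumDet v (M + s • 1 - vecMulVec (u b) (u b)) ≤ 0 := by
    intro b
    obtain ⟨s₀, hs₀, hle⟩ := hc b
    refine ⟨s₀, hs₀, fun s hs hss => ?_⟩
    have h1 := antitoneOn_sumDet_ratio v (u b) hM hpos (Set.mem_Ioi.2 hs) (Set.mem_Ioi.2 hs₀) hss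
    have h2 : 1 ≤ (sumDet v (M + s₀ • 1) -
        sumDet v (M + s₀ • 1 - vecMulVec (u b) (u b))) / sumDet v (M + s₀ • 1) := by
      rw [le_div_iff₀ (hpos _ hs₀)]
      linarith
    have h3 := h2.trans h1
    rw [le_div_iff₀ (hpos _ hs)] at h3
    linarith
  obtain ⟨s₁, hs₁, h₁⟩ := hratio true
  obtain ⟨s₂, hs₂, h₂⟩ := hratio false
  have hmin := lt_min hs₁ hs₂
  linarith [h _ hmin, h₁ _ hmin (min_le_left _ _), h₂ _ hmin (min_le_right _ _)]

theorem exists_det_pos_of_sumDet_pos_fin {m : ℕ} (v : Fin m → Bool → V → ℝ) {M : Matrix V V ℝ}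
    (hM : M.IsSymm) (h : ∀ s : ℝ, 0 < s → 0 < sumDet v (M + s • 1)) :
    ∃ ε : Fin m → Bool, ∀ s : ℝ, 0 < s →
      0 < (M + s • 1 - ∑ i, vecMulVec (v i (ε i)) (v i (ε i))).det := by
  induction m generalizing M with
  | zero => exact ⟨default, fun s hs => by simpa [sumDet_zero] using h s hs⟩
  | succ m ih =>
    simp only [sumDet_succ] at h
    obtain ⟨b, hb⟩ := exists_sumDet_sub_pos _ (v 0) hM h
    obtain ⟨ε, hε⟩ := ih (fun i => v i.succ) (M := M - vecMulVec (v 0 b) (v 0 b))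
      (hM.sub (by ext i j; simp [vecMulVec_apply, mul_comm]))
      (fun s hs => by simpa only [sub_add_eq_add_sub] using hb s hs)
    refine ⟨Fin.cons b ε, fun s hs => ?_⟩
    have := hε s hs
    rw [Fin.sum_univ_succ]
    simp only [Fin.cons_zero, Fin.cons_succ]
    rwa [← sub_sub, add_sub_right_comm]

/-- If the sum of the polynomials `det (M + s - ∑ i, vᵢ vᵢᵀ)` over all choices of `vᵢ` in the pair
`v i` has no positive root, then the same holds for one of these choices. -/
theorem exists_det_pos_of_sumDet_pos {ι : Type*} [Fintype ι] [DecidableEq ι]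
    (v : ι → Bool → V → ℝ) {M : Matrix V V ℝ}
    (hM : M.IsSymm) (h : ∀ s : ℝ, 0 < s → 0 < sumDet v (M + s • 1)) :
    ∃ ε : ι → Bool, ∀ s : ℝ, 0 < s →
      0 < (M + s • 1 - ∑ i, vecMulVec (v i (ε i)) (v i (ε i))).det := by
  let e := (Fintype.equivFin ι).symm
  obtain ⟨ε, hε⟩ := exists_det_pos_of_sumDet_pos_fin (fun i => v (e i)) hM
    (fun s hs => by rw [sumDet_reindex]; exact h s hs)
  refine ⟨ε ∘ e.symm, fun s hs => ?_⟩
  rw [← e.sum_comp]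
  simpa using hε s hs

end

/-! ### Signed adjacency matrices and the matching polynomial -/

/-- The sign `1` or `-1` that a Boolean encodes. -/
def boolSign (b : Bool) : ℝ := if b then 1 else -1

theorem boolSign_mul_self (b : Bool) : boolSign b * boolSign b = 1 := by
  cases b <;> simp [boolSign]

theorem boolSign_not (b : Bool) : boolSign (!b) = -boolSign b := by
  cases b <;> simp [boolSign]

section
variable {V : Type*} [DecidableEq V] (G : SimpleGraph V) [DecidableRel G.Adj]

/-- The adjacency matrix of `G` with the sign `ε e` on each edge `e`. -/
def signedAdjMatrix (ε : Sym2 V → Bool) : Matrix V V ℝ :=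
  of fun i j => if G.Adj i j then boolSign (ε s(i, j)) else 0

theorem isSymm_signedAdjMatrix {V : Type*} (G : SimpleGraph V) [DecidableRel G.Adj]
    (ε : Sym2 V → Bool) : (signedAdjMatrix G ε).IsSymm := by
  ext i j
  simp [signedAdjMatrix, G.adj_comm, Sym2.eq_swap]

/-- The matrix `x - A` for the signed adjacency matrix `A`, with the rows outside of `S` replaced by
those of the identity matrix; its determinant is that of the principal submatrix on `S`. -/
def signedCharMatrix (x : ℝ) (S : Finset V) (ε : Sym2 V → Bool) : Matrix V V ℝ :=
  of fun i => if i ∈ S then (x • 1 - signedAdjMatrix G ε) i else (1 : Matrix V V ℝ) i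

/-- Change the sign of the edge `e`. -/
def flipSign (e : Sym2 V) : (Sym2 V → Bool) ≃ (Sym2 V → Bool) :=
  Function.Involutive.toPerm (fun ε => Function.update ε e (!ε e)) fun ε => by simp

theorem flipSign_self (e : Sym2 V) (ε : Sym2 V → Bool) : flipSign e ε e = !ε e := by
  change Function.update ε e (!ε e) e = _
  rw [Function.update_self]

theorem flipSign_of_ne {e e' : Sym2 V} (h : e' ≠ e) (ε : Sym2 V → Bool) :
    flipSign e ε e' = ε e' := by
  change Function.update ε e (!ε e) e' = _
  rw [Function.update_of_ne h]

theorem signedCharMatrix_erase (x : ℝ) (S : Finset V) (ε : Sym2 V → Bool) (v : V) :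
    signedCharMatrix G x (S.erase v) ε =
      (signedCharMatrix G x S ε).updateRow v ((1 : Matrix V V ℝ) v) := by
  ext i j
  rw [updateRow_apply]
  by_cases hi : i = v <;> simp [signedCharMatrix, hi]

/-- For an edge `e = {a, b}` of `G`, the vectors `δ_a + δ_b` and `δ_a - δ_b`; for a nonedge, zero
vectors. -/
noncomputable def edgeVector (e : Sym2 V) (b : Bool) : V → ℝ :=
  if e ∈ G.edgeSet then Pi.single e.out.1 1 + boolSign b • Pi.single e.out.2 1 else 0

/-- The order of the two ends in `e.out` is arbitrary but cancels in the outer product; the sign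
affects only the off-diagonal entries. -/
theorem vecMulVec_edgeVector (e : Sym2 V) (b : Bool) (i j : V) :
    vecMulVec (edgeVector G e b) (edgeVector G e b) i j =
      if e ∈ G.edgeSet then
        if i = j then (if i ∈ e then 1 else 0) else if s(i, j) = e then boolSign b else 0
      else 0 := by
  unfold edgeVector
  by_cases he : e ∈ G.edgeSet
  · rw [if_pos he, if_pos he]
    have hout : s(e.out.1, e.out.2) = e := Quot.out_eq e
    have hab : e.out.1 ≠ e.out.2 := by
      rw [← hout, SimpleGraph.mem_edgeSet] at he
      exact he.ne
    generalize e.out.1 = p at *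
    generalize e.out.2 = q at *
    have hb := boolSign_mul_self b
    subst hout
    simp only [vecMulVec_apply, Pi.add_apply, Pi.smul_apply, Pi.single_apply, smul_eq_mul]
    simp only [Sym2.mem_iff, Sym2.eq_iff]
    grind
  · simp [he]

variable [Fintype V]

/-- The sum of the characteristic polynomials of all signed adjacency matrices of the subgraph
induced on `S`: a multiple of its matching polynomial. -/
noncomputable def matchingSum (x : ℝ) (S : Finset V) : ℝ :=
  ∑ ε : Sym2 V → Bool, (signedCharMatrix G x S ε).det

theorem det_swap_rows_eq (M : Matrix V V ℝ) {u v : V} (huv : u ≠ v) :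
    ((M.updateRow v ((1 : Matrix V V ℝ) u)).updateRow u ((1 : Matrix V V ℝ) v)).det =
      -((M.updateRow v ((1 : Matrix V V ℝ) v)).updateRow u ((1 : Matrix V V ℝ) u)).det := by
  have h := det_permute (Equiv.swap u v)
    ((M.updateRow v ((1 : Matrix V V ℝ) v)).updateRow u ((1 : Matrix V V ℝ) u))
  rw [Equiv.Perm.sign_swap huv] at h
  simp only [Units.val_neg, Units.val_one, Int.cast_neg, Int.cast_one, neg_mul, one_mul] at h
  rw [← h]
  congr 1
  ext i j
  simp only [submatrix_apply, updateRow_apply, id]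
  by_cases h1 : i = u
  · simp [h1, huv.symm]
  · by_cases h2 : i = v
    · simp [h2, huv.symm]
    · simp [h1, h2, Equiv.swap_apply_of_ne_of_ne h1 h2]

/-- Split off from row `u` its entry in column `v`. The rest, with row `r ε`, does not involve the
sign of `{v, u}`, so it cancels when that sign is flipped. In the split-off part the two signs
multiply to `1`, and exchanging rows `u` and `v` absorbs the minus. -/
theorem sum_boolSign_mul_det (x : ℝ) {S : Finset V} {u v : V} (hu : u ∈ S) (huv : G.Adj v u) :
    ∑ ε : Sym2 V → Bool, boolSign (ε s(v, u)) *
      ((signedCharMatrix G x S ε).updateRow v ((1 : Matrix V V ℝ) u)).det =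
      matchingSum G x ((S.erase v).erase u) := by
  have hne : u ≠ v := huv.ne'
  let r : (Sym2 V → Bool) → V → ℝ := fun ε =>
    (signedCharMatrix G x S ε u) + boolSign (ε s(v, u)) • (1 : Matrix V V ℝ) v
  have hdet : ∀ ε, ((signedCharMatrix G x S ε).updateRow v ((1 : Matrix V V ℝ) u)).det =
      (((signedCharMatrix G x S ε).updateRow v ((1 : Matrix V V ℝ) u)).updateRow u (r ε)).det -
      boolSign (ε s(v, u)) * (((signedCharMatrix G x S ε).updateRow v
        ((1 : Matrix V V ℝ) u)).updateRow u ((1 : Matrix V V ℝ) v)).det := by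
    intro ε
    rw [det_updateRow_add, det_updateRow_smul, add_sub_cancel_right]
    congr 1
    ext i j
    by_cases h : i = u
    · simp [updateRow_apply, h, hne]
    · simp [updateRow_apply, h]
  have hflip : ∑ ε : Sym2 V → Bool, boolSign (ε s(v, u)) * (((signedCharMatrix G x S ε).updateRow v
      ((1 : Matrix V V ℝ) u)).updateRow u (r ε)).det = 0 := by
    have h := (flipSign s(v, u)).sum_comp fun ε : Sym2 V → Bool => boolSign (ε s(v, u)) *
      (((signedCharMatrix G x S ε).updateRow v ((1 : Matrix V V ℝ) u)).updateRow u (r ε)).det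
    have hmat : ∀ ε, ((signedCharMatrix G x S (flipSign s(v, u) ε)).updateRow v
        ((1 : Matrix V V ℝ) u)).updateRow u (r (flipSign s(v, u) ε)) =
        ((signedCharMatrix G x S ε).updateRow v ((1 : Matrix V V ℝ) u)).updateRow u (r ε) := by
      intro ε
      ext i j
      simp only [updateRow_apply]
      by_cases h1 : i = u
      · rw [if_pos h1, if_pos h1]
        by_cases h2 : j = v
        · subst h2
          simp [r, signedCharMatrix, hu, signedAdjMatrix, huv.symm, hne, Sym2.eq_swap (a := u)]
        · have : s(u, j) ≠ s(v, u) := by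
            simp only [ne_eq, Sym2.eq_iff]; tauto
          simp [r, signedCharMatrix, hu, signedAdjMatrix, flipSign_of_ne this, Ne.symm h2]
      · rw [if_neg h1, if_neg h1]
        by_cases h2 : i = v
        · rw [if_pos h2, if_pos h2]
        · rw [if_neg h2, if_neg h2]
          have : s(i, j) ≠ s(v, u) := by
            simp only [ne_eq, Sym2.eq_iff]; tauto
          by_cases h3 : i ∈ S <;>
            simp [signedCharMatrix, h3, signedAdjMatrix, flipSign_of_ne this]
    simp only [hmat, flipSign_self, boolSign_not, neg_mul, Finset.sum_neg_distrib] at h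
    linarith
  have hterm : ∀ ε, boolSign (ε s(v, u)) *
      ((signedCharMatrix G x S ε).updateRow v ((1 : Matrix V V ℝ) u)).det =
      boolSign (ε s(v, u)) * (((signedCharMatrix G x S ε).updateRow v
        ((1 : Matrix V V ℝ) u)).updateRow u (r ε)).det +
      (signedCharMatrix G x ((S.erase v).erase u) ε).det := by
    intro ε
    rw [signedCharMatrix_erase, signedCharMatrix_erase, hdet, mul_sub, ← mul_assoc,
      boolSign_mul_self, one_mul, det_swap_rows_eq _ hne, sub_neg_eq_add]
  rw [Finset.sum_congr rfl fun ε _ => hterm ε, Finset.sum_add_distrib, hflip, zero_add]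
  rfl

/-- The vertex recurrence of the matching polynomial, by expanding each determinant along row `v`.
-/
theorem matchingSum_eq (x : ℝ) {S : Finset V} {v : V} (hv : v ∈ S) :
    matchingSum G x S = x * matchingSum G x (S.erase v) -
      ∑ u ∈ S with G.Adj v u, matchingSum G x ((S.erase v).erase u) := by
  have hdet : ∀ ε, (signedCharMatrix G x S ε).det = x * (signedCharMatrix G x (S.erase v) ε).det -
      ∑ u ∈ S with G.Adj v u, boolSign (ε s(v, u)) *
        ((signedCharMatrix G x S ε).updateRow v ((1 : Matrix V V ℝ) u)).det := by
    intro ε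
    have hrow : signedCharMatrix G x S ε v = x • (1 : Matrix V V ℝ) v +
        ∑ u, (-(if G.Adj v u then boolSign (ε s(v, u)) else 0)) • (1 : Matrix V V ℝ) u := by
      ext j
      simp only [Pi.add_apply, Pi.smul_apply, Finset.sum_apply, Matrix.one_apply, smul_eq_mul,
        mul_ite, mul_one, mul_zero, Finset.sum_ite_eq', Finset.mem_univ, if_true]
      simp [signedCharMatrix, hv, signedAdjMatrix, Matrix.one_apply, sub_eq_add_neg]
    have hlin : ∀ (c : V → ℝ) (T : Finset V),
        ((signedCharMatrix G x S ε).updateRow v (∑ u ∈ T, c u • (1 : Matrix V V ℝ) u)).det =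
        ∑ u ∈ T, c u * ((signedCharMatrix G x S ε).updateRow v ((1 : Matrix V V ℝ) u)).det := by
      intro c T
      induction T using Finset.induction_on with
      | empty => simpa using det_eq_zero_of_row_eq_zero v (by simp)
      | insert a T ha ih =>
        rw [Finset.sum_insert ha, Finset.sum_insert ha, det_updateRow_add, det_updateRow_smul, ih]
    conv_lhs => rw [← updateRow_eq_self (signedCharMatrix G x S ε) v, hrow]
    rw [det_updateRow_add, det_updateRow_smul, ← signedCharMatrix_erase, hlin, sub_eq_add_neg,
      ← Finset.sum_neg_distrib, Finset.sum_filter]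
    congr 1
    rw [← Finset.sum_subset (Finset.subset_univ S)]
    · refine Finset.sum_congr rfl fun u _ => ?_
      split_ifs <;> simp
    · intro u _ hu
      have hne : u ≠ v := fun h => hu (h ▸ hv)
      -- For `u` outside `S`, rows `u` and `v` are both the unit vector at `u`.
      rw [det_zero_of_row_eq hne, mul_zero]
      rw [updateRow_self, updateRow_ne hne]
      ext j
      simp [signedCharMatrix, hu]
  unfold matchingSum
  rw [Finset.sum_congr rfl fun ε _ => hdet ε, Finset.sum_sub_distrib, ← Finset.mul_sum,
    Finset.sum_comm]
  congr 1
  refine Finset.sum_congr rfl fun u hu => ?_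
  rw [Finset.mem_filter] at hu
  exact sum_boolSign_mul_det G x hu.1 hu.2

/-- Heilmann–Lieb. Write `μ` for `matchingSum` and `q = √(d - 1)`. The recurrence gives `μ(S) / μ(S
- v) ≥ x - deg / q`, because each neighbour `u` has lost `v` and so satisfies the ratio bound in `S
- v`. For `deg ≤ d - 1` this is at least `x - q ≥ q`; for `deg = d` it is still positive, as `d ≥
2`. -/
theorem matchingSum_pos_and_ratio {d : ℕ} (hd : 2 ≤ d) (hdeg : ∀ v, G.degree v ≤ d) {x : ℝ}
    (hx : 2 * √((d : ℝ) - 1) < x) (S : Finset V) :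
    0 < matchingSum G x S ∧ ∀ v ∈ S, (S.filter (G.Adj v)).card < d →
      √((d : ℝ) - 1) * matchingSum G x (S.erase v) ≤ matchingSum G x S := by
  have hd' : (2 : ℝ) ≤ d := by exact_mod_cast hd
  set q := √((d : ℝ) - 1) with hq
  have hqq : q * q = d - 1 := Real.mul_self_sqrt (by linarith)
  have hq1 : 1 ≤ q := by rw [hq, Real.one_le_sqrt]; linarith
  induction hn : S.card generalizing S with
  | zero =>
    rw [Finset.card_eq_zero] at hn
    subst hn
    refine ⟨?_, by simp⟩
    have : ∀ ε, signedCharMatrix G x ∅ ε = 1 := fun ε => by ext; simp [signedCharMatrix]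
    simp [matchingSum, this]
  | succ n ih =>
    have key : ∀ v ∈ S, 0 < matchingSum G x (S.erase v) ∧
        (q * x - (S.filter (G.Adj v)).card) * matchingSum G x (S.erase v) ≤
          q * matchingSum G x S := by
      intro v hv
      obtain ⟨hpos, hr⟩ := ih (S.erase v) (by rw [Finset.card_erase_of_mem hv, hn]; rfl)
      refine ⟨hpos, ?_⟩
      have hsum : ∑ u ∈ S with G.Adj v u, q * matchingSum G x ((S.erase v).erase u) ≤
          ∑ u ∈ S with G.Adj v u, matchingSum G x (S.erase v) := by
        refine Finset.sum_le_sum fun u hu => ?_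
        rw [Finset.mem_filter] at hu
        refine hr u (Finset.mem_erase.2 ⟨hu.2.ne', hu.1⟩) ?_
        refine lt_of_lt_of_le (Finset.card_lt_card ?_) (hdeg u)
        rw [Finset.ssubset_iff_of_subset]
        · exact ⟨v, by simpa using hu.2.symm, by simp⟩
        · intro w hw
          simpa using (Finset.mem_filter.1 hw).2
      rw [← Finset.mul_sum, Finset.sum_const, nsmul_eq_mul] at hsum
      rw [matchingSum_eq G x hv]
      linarith
    constructor
    · obtain ⟨v, hv⟩ : S.Nonempty := by rw [← Finset.card_pos]; omega
      obtain ⟨hpos, hle⟩ := key v hv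
      have hc : ((S.filter (G.Adj v)).card : ℝ) ≤ d := by
        exact_mod_cast (Finset.card_le_card fun w hw => by
          simpa using (Finset.mem_filter.1 hw).2).trans (hdeg v)
      have h1 : 0 < q * x - (S.filter (G.Adj v)).card := by nlinarith
      exact pos_of_mul_pos_right ((mul_pos h1 hpos).trans_le hle) (by linarith)
    · intro v hv hcard
      obtain ⟨hpos, hle⟩ := key v hv
      have hc : ((S.filter (G.Adj v)).card : ℝ) ≤ d - 1 := by
        have : ((S.filter (G.Adj v)).card : ℝ) + 1 ≤ d := by exact_mod_cast hcard
        linarith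
      have h1 : q * q ≤ q * x - (S.filter (G.Adj v)).card := by nlinarith
      refine le_of_mul_le_mul_left ?_ (zero_lt_one.trans_le hq1)
      calc q * (q * matchingSum G x (S.erase v)) = q * q * matchingSum G x (S.erase v) := by ring
        _ ≤ _ := mul_le_mul_of_nonneg_right h1 hpos.le
        _ ≤ _ := hle

theorem sum_vecMulVec_edgeVector {d : ℕ} (hreg : G.IsRegularOfDegree d) (ε : Sym2 V → Bool) :
    ∑ e, vecMulVec (edgeVector G e (ε e)) (edgeVector G e (ε e)) =
      (d : ℝ) • 1 + signedAdjMatrix G ε := by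
  ext i j
  rw [Matrix.sum_apply]
  simp only [vecMulVec_edgeVector]
  rcases eq_or_ne i j with rfl | hij
  · have : ∀ e : Sym2 V, (if e ∈ G.edgeSet then if i = i then if i ∈ e then (1 : ℝ) else 0
        else if s(i, i) = e then boolSign (ε e) else 0 else 0) =
        if e ∈ G.incidenceFinset i then 1 else 0 := by
      intro e
      simp only [SimpleGraph.mem_incidenceFinset, SimpleGraph.incidenceSet, Set.mem_ofPred_eq]
      split_ifs <;> simp_all
    rw [Finset.sum_congr rfl fun e _ => this e, Finset.sum_ite_mem, Finset.univ_inter,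
      Finset.sum_const, SimpleGraph.card_incidenceFinset_eq_degree, hreg i]
    simp [signedAdjMatrix]
  · rw [Finset.sum_eq_single s(i, j)]
    · simp [hij, signedAdjMatrix]
    · intro e _ he
      simp [hij, he.symm]
    · simp

/-- Every regular graph of degree `d ≥ 2` has a signed adjacency matrix whose largest eigenvalue is
at most `2 √(d - 1)`. -/
theorem exists_signedAdjMatrix_le {d : ℕ} (hd : 2 ≤ d) (hreg : G.IsRegularOfDegree d) :
    ∃ ε : Sym2 V → Bool, ∀ y : V → ℝ,
      y ⬝ᵥ signedAdjMatrix G ε *ᵥ y ≤ 2 * √((d : ℝ) - 1) * (y ⬝ᵥ y) := by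
  set c := 2 * √((d : ℝ) - 1) with hc
  -- Starting from `c + d`, subtracting all edge matrices leaves `c - A_ε`, so the shift `s`
  -- evaluates the characteristic polynomial at `c + s`.
  have hM : ((c + d) • (1 : Matrix V V ℝ)).IsSymm := isSymm_one.smul _
  have hmat : ∀ (s : ℝ) (ε : Sym2 V → Bool), (c + d) • (1 : Matrix V V ℝ) + s • 1 -
      ∑ e, vecMulVec (edgeVector G e (ε e)) (edgeVector G e (ε e)) =
      (c + s) • 1 - signedAdjMatrix G ε := by
    intro s ε
    rw [sum_vecMulVec_edgeVector G hreg]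
    module
  obtain ⟨ε, hε⟩ := exists_det_pos_of_sumDet_pos (edgeVector G) hM (by
    intro s hs
    have := (matchingSum_pos_and_ratio G hd (fun v => (hreg v).le) (x := c + s)
      (by linarith) Finset.univ).1
    simp only [sumDet, hmat]
    convert this using 1
    refine Finset.sum_congr rfl fun ε _ => congrArg det ?_
    ext
    simp [signedCharMatrix])
  simp only [hmat] at hε
  refine ⟨ε, ?_⟩
  have hherm : (c • 1 - signedAdjMatrix G ε).IsHermitian := by
    rw [IsHermitian, conjTranspose_eq_transpose_of_trivial]
    exact (isSymm_one.smul c).sub (isSymm_signedAdjMatrix G ε)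
  have hpsd : (c • 1 - signedAdjMatrix G ε).PosSemidef := by
    rw [hherm.posSemidef_iff_eigenvalues_nonneg]
    intro i
    by_contra! hneg
    simp only [Pi.zero_apply] at hneg
    have hdet := hε (-hherm.eigenvalues i) (by linarith)
    have h0 : ((c + -hherm.eigenvalues i) • 1 - signedAdjMatrix G ε).det = 0 := by
      refine exists_mulVec_eq_zero_iff.1 ⟨hherm.eigenvectorBasis i, ?_, ?_⟩
      · intro h
        exact hherm.eigenvectorBasis.orthonormal.ne_zero i (by ext j; simpa using congrFun h j)
      · have := hherm.mulVec_eigenvectorBasis i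
        have e : (c + -hherm.eigenvalues i) • 1 - signedAdjMatrix G ε =
          (c • 1 - signedAdjMatrix G ε) - hherm.eigenvalues i • 1 := by module
        rw [e, sub_mulVec, this, smul_mulVec, one_mulVec, sub_self]
    linarith
  intro y
  have := hpsd.dotProduct_mulVec_nonneg y
  rw [sub_mulVec, smul_mulVec, one_mulVec, dotProduct_sub, dotProduct_smul, star_trivial,
    smul_eq_mul] at this
  linarith

end

/-! ### From positive semidefinite matrices to equiangular lines -/

theorem Matrix.IsHermitian.apply_eq_sum {W : Type*} [Fintype W] [DecidableEq W]
    {M : Matrix W W ℝ} (hM : M.IsHermitian) (i j : W) :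
    M i j = ∑ l, hM.eigenvalues l * (hM.eigenvectorBasis l i * hM.eigenvectorBasis l j) := by
  conv_lhs => rw [hM.spectral_theorem, Unitary.conjStarAlgAut_apply, mul_apply]
  refine Finset.sum_congr rfl fun l _ => ?_
  rw [mul_diagonal]
  simp [star_apply]
  ring

/-- Use the eigenvector coordinates scaled by the square roots of the eigenvalues; only the nonzero
eigenvalues, as many as the rank, need a coordinate. -/
theorem Matrix.PosSemidef.exists_inner_eq {W : Type*} [Fintype W] [DecidableEq W]
    {M : Matrix W W ℝ} (hM : M.PosSemidef) {m : ℕ} (hr : M.rank ≤ m) :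
    ∃ y : W → EuclideanSpace ℝ (Fin m), ∀ i j, inner ℝ (y i) (y j) = M i j := by
  have hH := hM.isHermitian
  rw [hH.rank_eq_card_non_zero_eigs] at hr
  obtain ⟨f⟩ : Nonempty ({l // hH.eigenvalues l ≠ 0} ↪ Fin m) :=
    Function.Embedding.nonempty_of_card_le (by simpa using hr)
  have ho : Orthonormal ℝ fun l => EuclideanSpace.basisFun (Fin m) ℝ (f l) :=
    (EuclideanSpace.basisFun (Fin m) ℝ).orthonormal.comp f f.injective
  refine ⟨fun i => ∑ l : {l // hH.eigenvalues l ≠ 0}, (√(hH.eigenvalues l) *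
    hH.eigenvectorBasis l i) • EuclideanSpace.basisFun (Fin m) ℝ (f l), fun i j => ?_⟩
  rw [ho.inner_sum, hH.apply_eq_sum i j]
  have h1 : ∀ l : W, starRingEnd ℝ (√(hH.eigenvalues l) * hH.eigenvectorBasis l i) *
      (√(hH.eigenvalues l) * hH.eigenvectorBasis l j) =
      hH.eigenvalues l * (hH.eigenvectorBasis l i * hH.eigenvectorBasis l j) := by
    intro l
    have := Real.mul_self_sqrt (hM.eigenvalues_nonneg l)
    simp only [conj_trivial]
    linear_combination (hH.eigenvectorBasis l i * hH.eigenvectorBasis l j) * this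
  refine (Finset.sum_congr rfl fun (l : {l // hH.eigenvalues l ≠ 0}) _ => h1 l).trans ?_
  rw [← Finset.sum_subtype (Finset.univ.filter fun l => hH.eigenvalues l ≠ 0) (by simp)
    fun l => hH.eigenvalues l * (hH.eigenvectorBasis l i * hH.eigenvectorBasis l j)]
  exact Finset.sum_filter_of_ne fun l _ h => left_ne_zero_of_mul h

theorem card_le_maxEquiangularLines {W : Type*} [Fintype W] {α : ℝ} (hα0 : 0 ≤ α) (hα1 : α < 1)
    {m : ℕ} (y : W → EuclideanSpace ℝ (Fin m)) (hunit : ∀ i, inner ℝ (y i) (y i) = (1 : ℝ))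
    (hangle : ∀ i j, i ≠ j → inner ℝ (y i) (y j) = α ∨ inner ℝ (y i) (y j) = -α) :
    (Fintype.card W : ℕ∞) ≤ maxEquiangularLines α m := by
  have hnorm : ∀ i, ‖y i‖ = 1 := fun i => by
    have := real_inner_self_eq_norm_sq (y i)
    rw [hunit] at this
    nlinarith [norm_nonneg (y i)]
  have hne : ∀ i, y i ≠ 0 := fun i h => by simpa [h] using hnorm i
  have hinj : Function.Injective fun i => Submodule.span ℝ {y i} := by
    intro i j hij
    by_contra hne'
    have hmem : y j ∈ Submodule.span ℝ {y i} := by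
      simp only at hij
      rw [hij]
      exact Submodule.mem_span_singleton_self _
    obtain ⟨c, hc⟩ := Submodule.mem_span_singleton.1 hmem
    have hcn : |c| = 1 := by
      have := hnorm j
      rwa [← hc, norm_smul, hnorm, mul_one] at this
    have hin : inner ℝ (y i) (y j) = c := by
      rw [← hc, inner_smul_right, hunit, mul_one]
    rcases hangle i j hne' with h | h
    · rw [h] at hin
      rw [← hin, abs_of_nonneg hα0] at hcn
      linarith
    · rw [h] at hin
      rw [← hin, abs_neg, abs_of_nonneg hα0] at hcn
      linarith
  have hL : IsEquiangularLines α (Set.range fun i => Submodule.span ℝ {y i}) := by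
    constructor
    · rintro _ ⟨i, rfl⟩
      exact finrank_span_singleton (hne i)
    · rintro _ ⟨i, rfl⟩ _ ⟨j, rfl⟩ hij
      have hij' : i ≠ j := fun h => hij (by rw [h])
      have hle : Real.arccos α ≤ Real.pi / 2 := Real.arccos_le_pi_div_two.2 hα0
      rcases hangle i j hij' with h | h
      · refine ⟨y i, Submodule.mem_span_singleton_self _, y j,
          Submodule.mem_span_singleton_self _, hne i, hne j, hle, ?_⟩
        simp [InnerProductGeometry.angle, hnorm, h]
      · refine ⟨y i, Submodule.mem_span_singleton_self _, -y j,
          Submodule.neg_mem _ (Submodule.mem_span_singleton_self _), hne i,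
          neg_ne_zero.2 (hne j), hle, ?_⟩
        simp [InnerProductGeometry.angle, hnorm, h]
  refine le_trans (le_of_eq ?_) (le_iSup₂
    (f := fun (L : Set (Submodule ℝ (EuclideanSpace ℝ (Fin m))))
      (_ : IsEquiangularLines α L) => L.encard) _ hL)
  rw [← Set.image_univ, hinj.encard_image, Set.encard_univ, ENat.card_eq_coe_fintype_card]

/-! ### The Gram matrix of a regular graph with isolated vertices -/

section
variable {V : Type*} [Fintype V] [DecidableEq V] (G : SimpleGraph V) [DecidableRel G.Adj]

/-- The matrix `lam - A + J / 2`, where `A` is the adjacency matrix of the graph `G` with `t`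
isolated vertices added. -/
noncomputable def seidelGram (lam : ℝ) (t : ℕ) : Matrix (V ⊕ Fin t) (V ⊕ Fin t) ℝ :=
  fromBlocks (lam • 1 - G.adjMatrix ℝ) 0 0 (lam • 1) + (1 / 2 : ℝ) • vecMulVec 1 1

theorem seidelGram_mulVec (lam : ℝ) (t : ℕ) (z : V ⊕ Fin t → ℝ) :
    seidelGram G lam t *ᵥ z = Sum.elim (lam • (z ∘ Sum.inl) - G.adjMatrix ℝ *ᵥ (z ∘ Sum.inl))
      (lam • (z ∘ Sum.inr)) + fun _ => (1 / 2 : ℝ) * ∑ i, z i := by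
  rw [seidelGram, add_mulVec, fromBlocks_mulVec, smul_mulVec (1 / 2 : ℝ),
    vecMulVec_mulVec]
  simp only [sub_mulVec, smul_mulVec, one_mulVec, zero_mulVec, add_zero, zero_add]
  congr 1
  ext i
  simp [dotProduct]

theorem isHermitian_seidelGram {V : Type*} [DecidableEq V] (G : SimpleGraph V) [DecidableRel G.Adj]
    (lam : ℝ) (t : ℕ) : (seidelGram G lam t).IsHermitian := by
  ext i j
  rcases i with i | i <;> rcases j with j | j <;>
    simp [seidelGram, Matrix.one_apply, eq_comm, G.adj_comm]

theorem dotProduct_seidelGram_mulVec (lam : ℝ) (t : ℕ) (z : V ⊕ Fin t → ℝ) :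
    z ⬝ᵥ seidelGram G lam t *ᵥ z = lam * ((z ∘ Sum.inl) ⬝ᵥ (z ∘ Sum.inl)) -
      (z ∘ Sum.inl) ⬝ᵥ G.adjMatrix ℝ *ᵥ (z ∘ Sum.inl) +
      lam * ((z ∘ Sum.inr) ⬝ᵥ (z ∘ Sum.inr)) +
      (1 / 2 : ℝ) * (∑ i, z (Sum.inl i) + ∑ j, z (Sum.inr j)) ^ 2 := by
  rw [seidelGram_mulVec, dotProduct_add]
  have h1 : ∀ c : ℝ, (z ⬝ᵥ fun _ => c) = c * ∑ i, z i := by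
    intro c
    rw [Finset.mul_sum]
    simp [dotProduct, mul_comm]
  have h2 : ∀ (p : V → ℝ) (q : Fin t → ℝ), z ⬝ᵥ Sum.elim p q =
      (z ∘ Sum.inl) ⬝ᵥ p + (z ∘ Sum.inr) ⬝ᵥ q := by
    intro p q
    simp [dotProduct]
  rw [h1, h2, dotProduct_sub, dotProduct_smul, dotProduct_smul, Fintype.sum_sum_type]
  simp only [smul_eq_mul]
  ring

theorem sum_adjMatrix_mulVec {V : Type*} [Fintype V] (G : SimpleGraph V) [DecidableRel G.Adj]
    {d : ℕ} (hreg : G.IsRegularOfDegree d) (f : V → ℝ) :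
    ∑ i, (G.adjMatrix ℝ *ᵥ f) i = d * ∑ i, f i := by
  have h : (1 : V → ℝ) ⬝ᵥ G.adjMatrix ℝ *ᵥ f = (d : ℝ) * ((1 : V → ℝ) ⬝ᵥ f) := by
    rw [dotProduct_mulVec, ← mulVec_transpose, SimpleGraph.transpose_adjMatrix]
    have : G.adjMatrix ℝ *ᵥ 1 = (d : ℝ) • (1 : V → ℝ) := by
      ext i
      have := SimpleGraph.adjMatrix_mulVec_const_apply_of_regular (α := ℝ) (a := 1) hreg (v := i)
      simpa using this
    rw [this, smul_dotProduct, smul_eq_mul]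
  simpa [dotProduct] using h

/-- Split `f` into its mean, on which `A` acts as `d`, and a sum-zero part, to which `hform`
applies. -/
theorem card_mul_dotProduct_adjMatrix_le {V : Type*} [Fintype V] (G : SimpleGraph V)
    [DecidableRel G.Adj] {d : ℕ} (hreg : G.IsRegularOfDegree d) {lam : ℝ}
    (hform : ∀ f : V → ℝ, ∑ i, f i = 0 → f ⬝ᵥ G.adjMatrix ℝ *ᵥ f ≤ lam * (f ⬝ᵥ f)) (f : V → ℝ) :
    Fintype.card V * (f ⬝ᵥ G.adjMatrix ℝ *ᵥ f) ≤
      Fintype.card V * (lam * (f ⬝ᵥ f)) + (d - lam) * (∑ i, f i) ^ 2 := by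
  rcases isEmpty_or_nonempty V with hV | hV
  · simp
  have hn : (0 : ℝ) < Fintype.card V := by exact_mod_cast Fintype.card_pos
  set n : ℝ := (Fintype.card V : ℝ) with hnd
  set a := ∑ i, f i with ha
  set o : V → ℝ := fun _ => a / n with ho
  have hAo : G.adjMatrix ℝ *ᵥ o = (d : ℝ) • o := by
    ext i
    simp [ho, hreg.degree_eq i]
  have hodot : ∀ g : V → ℝ, o ⬝ᵥ g = a / n * ∑ i, g i := by
    intro g
    simp [ho, dotProduct, Finset.mul_sum]
  have hosum : ∑ i, o i = a := by
    simp only [ho, Finset.sum_const, Finset.card_univ, nsmul_eq_mul, ← hnd]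
    field_simp
  have h := hform (f - o) (by simp only [Pi.sub_apply, Finset.sum_sub_distrib, hosum]; simp [ha])
  rw [mulVec_sub, hAo] at h
  simp only [sub_dotProduct, dotProduct_sub, dotProduct_smul, dotProduct_comm f o, hodot,
    sum_adjMatrix_mulVec G hreg, hosum, ← ha, smul_eq_mul] at h
  have e : a / n * a * n = a ^ 2 := by field_simp
  have h' := mul_le_mul_of_nonneg_left h hn.le
  linear_combination h' + (d - lam) * e

theorem posSemidef_seidelGram {d : ℕ} (hreg : G.IsRegularOfDegree d) {lam : ℝ} (hpos : 0 < lam)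
    (hform : ∀ f : V → ℝ, ∑ i, f i = 0 → f ⬝ᵥ G.adjMatrix ℝ *ᵥ f ≤ lam * (f ⬝ᵥ f))
    (hnd : 2 * d ≤ Fintype.card V) {t : ℕ}
    (ht : t = 0 ∨ t ≤ Fintype.card V ∧ 2 * (d : ℝ) / 3 ≤ lam) [Nonempty V] :
    (seidelGram G lam t).PosSemidef := by
  refine .of_dotProduct_mulVec_nonneg (isHermitian_seidelGram G lam t) fun z => ?_
  rw [star_trivial, dotProduct_seidelGram_mulVec]
  have h1 := card_mul_dotProduct_adjMatrix_le G hreg hform (z ∘ Sum.inl)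
  have hn : (0 : ℝ) < Fintype.card V := by exact_mod_cast Fintype.card_pos
  have hnd' : 2 * (d : ℝ) ≤ Fintype.card V := by exact_mod_cast hnd
  simp only [Function.comp_apply] at h1
  set n : ℝ := (Fintype.card V : ℝ) with hnn
  set a := ∑ i, z (Sum.inl i) with ha
  set b := ∑ j, z (Sum.inr j) with hb
  set g := (z ∘ Sum.inr) ⬝ᵥ (z ∘ Sum.inr) with hg
  have hg0 : 0 ≤ g := by
    simp only [hg, dotProduct]
    exact Finset.sum_nonneg fun i _ => mul_self_nonneg _
  have hbg : b ^ 2 ≤ t * g := by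
    have := sq_sum_le_card_mul_sum_sq (s := Finset.univ) (f := fun j : Fin t => z (Sum.inr j))
    simpa [hb, hg, dotProduct, sq] using this
  suffices h : 0 ≤ n * (lam * g) - (d - lam) * a ^ 2 + n / 2 * (a + b) ^ 2 by
    refine nonneg_of_mul_nonneg_right ?_ hn
    nlinarith
  rcases ht with rfl | ⟨ht, hl⟩
  · have hb0 : b = 0 := by simp [hb]
    rw [hb0, add_zero]
    have := mul_nonneg (mul_nonneg hn.le hpos.le) hg0
    nlinarith [sq_nonneg a]
  · have htn : (t : ℝ) ≤ n := by rw [hnn]; exact_mod_cast ht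
    have h2 : b ^ 2 ≤ n * g := hbg.trans (mul_le_mul_of_nonneg_right htn hg0)
    have h3 : lam * b ^ 2 ≤ n * (lam * g) := by nlinarith
    -- Cauchy–Schwarz with `t ≤ n`, and `n ≥ 2d`, remove `n` and leave a binary form in the two sums
    -- `a` and `b`. It is semidefinite once `λ ≥ (√5 - 1)d / 2`; the hypothesis `2d / 3` lies
    -- slightly above.
    have h4 : d * (a + b) ^ 2 ≤ n / 2 * (a + b) ^ 2 := by nlinarith [sq_nonneg (a + b)]
    suffices h : 0 ≤ lam * b ^ 2 - (d - lam) * a ^ 2 + d * (a + b) ^ 2 by linarith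
    have h5 : lam * b ^ 2 - (d - lam) * a ^ 2 + d * (a + b) ^ 2 =
      (lam - 2 * d / 3) * (a ^ 2 + b ^ 2) +
        d / 15 * (a ^ 2 + 9 * (a + 5 / 3 * b) ^ 2) := by ring
    rw [h5]
    have := sub_nonneg.2 hl
    positivity

/-- Since `λ < d`, a `λ`-eigenvector has sum zero; extended by zero it is killed by both `λ - A` and
`J`. -/
theorem rank_seidelGram_le {d : ℕ} (hreg : G.IsRegularOfDegree d) {lam : ℝ} (hd : lam < d) (t : ℕ) :
    (seidelGram G lam t).rank + eigenvalueMultiplicity G lam ≤ Fintype.card V + t := by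
  have hrank := LinearMap.finrank_range_add_finrank_ker (seidelGram G lam t).mulVecLin
  rw [Module.finrank_fintype_fun_eq_card, Fintype.card_sum, Fintype.card_fin] at hrank
  rw [← hrank]
  refine Nat.add_le_add_left ?_ _
  let φ : (V → ℝ) →ₗ[ℝ] (V ⊕ Fin t → ℝ) :=
    { toFun := fun f => Sum.elim f 0
      map_add' := fun f g => by ext (i | i) <;> simp
      map_smul' := fun c f => by ext (i | i) <;> simp }
  have hφ : Function.Injective φ := fun f g h => by
    ext i
    exact congrFun h (Sum.inl i)
  have hle : (Module.End.eigenspace (toLin' (G.adjMatrix ℝ)) lam).map φ ≤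
      LinearMap.ker (seidelGram G lam t).mulVecLin := by
    rintro _ ⟨f, hf, rfl⟩
    have hf' : G.adjMatrix ℝ *ᵥ f = lam • f := by simpa using Module.End.mem_eigenspace_iff.1 hf
    have hsum : ∑ i, f i = 0 := by
      have h := sum_adjMatrix_mulVec G hreg f
      rw [hf'] at h
      simp only [Pi.smul_apply, smul_eq_mul, ← Finset.mul_sum] at h
      have : (d - lam) * ∑ i, f i = 0 := by linarith
      exact (mul_eq_zero.1 this).resolve_left (sub_pos.2 hd).ne'
    rw [LinearMap.mem_ker, mulVecLin_apply, seidelGram_mulVec]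
    ext (i | i) <;> simp [φ, hf', hsum, Function.comp_def]
  rw [eigenvalueMultiplicity,
    (Submodule.equivMapOfInjective φ hφ
      (Module.End.eigenspace (toLin' (G.adjMatrix ℝ)) lam)).finrank_eq]
  exact Submodule.finrank_mono hle

theorem card_add_le_maxEquiangularLines {d : ℕ} (hreg : G.IsRegularOfDegree d) {lam α : ℝ}
    (hpos : 0 < lam) (hα : α = 1 / (2 * lam + 1))
    (hform : ∀ f : V → ℝ, ∑ i, f i = 0 → f ⬝ᵥ G.adjMatrix ℝ *ᵥ f ≤ lam * (f ⬝ᵥ f))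
    (hnd : 2 * d ≤ Fintype.card V) {t : ℕ}
    (ht : t = 0 ∨ t ≤ Fintype.card V ∧ 2 * (d : ℝ) / 3 ≤ lam) (hd : lam < d) [Nonempty V] {m : ℕ}
    (hm : Fintype.card V + t ≤ m + eigenvalueMultiplicity G lam) :
    ((Fintype.card V + t : ℕ) : ℕ∞) ≤ maxEquiangularLines α m := by
  have h21 : (0 : ℝ) < 2 * lam + 1 := by linarith
  have hα0 : 0 < α := by rw [hα]; positivity
  have hα1 : α < 1 := by rw [hα, div_lt_one h21]; linarith
  have hαl : 2 * α * lam + α = 1 := by rw [hα]; field_simp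
  have hpsd := (posSemidef_seidelGram G hreg hpos hform hnd ht).smul
    (show (0 : ℝ) ≤ 2 * α by linarith)
  have hrank : ((2 * α) • seidelGram G lam t).rank ≤ m := by
    rw [rank_smul_of_mem_nonZeroDivisors _
      (mem_nonZeroDivisors_of_ne_zero (by positivity))]
    have := rank_seidelGram_le G hreg hd t
    omega
  obtain ⟨y, hy⟩ := hpsd.exists_inner_eq hrank
  have := card_le_maxEquiangularLines hα0.le hα1 y (fun i => by
      rw [hy]
      rcases i with i | i <;> simp [seidelGram] <;> linarith)
    (fun i j hij => by
      rw [hy]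
      rcases i with i | i <;> rcases j with j | j
      · have hij' : i ≠ j := fun h => hij (by rw [h])
        by_cases hadj : G.Adj i j
        · right
          simp [seidelGram, hij', hadj]
          ring
        · left
          simp [seidelGram, hij', hadj]
          ring
      · left; simp [seidelGram]; ring
      · left; simp [seidelGram]; ring
      · have hij' : i ≠ j := fun h => hij (by rw [h])
        left; simp [seidelGram, hij']; ring)
  simpa using this

end

/-! ### Two-fold covers -/

section
variable {V : Type*} (G : SimpleGraph V)

/-- The two-fold cover of `G` in which the two sheets are joined straight over the edges with
sign `true` and crosswise over the others. -/
def liftGraph (ε : Sym2 V → Bool) : SimpleGraph (V × Bool) where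
  Adj p q := G.Adj p.1 q.1 ∧ (ε s(p.1, q.1) = true ↔ p.2 = q.2)
  symm := ⟨fun p q h => ⟨h.1.symm, by rw [Sym2.eq_swap, h.2, eq_comm]⟩⟩
  loopless := ⟨fun p h => h.1.ne rfl⟩

instance [DecidableRel G.Adj] (ε : Sym2 V → Bool) : DecidableRel (liftGraph G ε).Adj :=
  fun p q => inferInstanceAs (Decidable (G.Adj p.1 q.1 ∧ (ε s(p.1, q.1) = true ↔ p.2 = q.2)))

variable [DecidableRel G.Adj]

theorem adjMatrix_liftGraph_apply (ε : Sym2 V → Bool) (p q : V × Bool) :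
    (liftGraph G ε).adjMatrix ℝ p q = (G.adjMatrix ℝ p.1 q.1 +
      boolSign p.2 * boolSign q.2 * signedAdjMatrix G ε p.1 q.1) / 2 := by
  obtain ⟨i, b⟩ := p
  obtain ⟨j, c⟩ := q
  rw [SimpleGraph.adjMatrix_apply, SimpleGraph.adjMatrix_apply]
  by_cases h : G.Adj i j
  · cases hε : ε s(i, j) <;> cases b <;> cases c <;>
      simp [liftGraph, signedAdjMatrix, boolSign, h, hε]
  · simp [liftGraph, signedAdjMatrix, h]

variable [Fintype V]

/-- The lift acts as `A` on sums over the two sheets and as the signed matrix on differences, which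
splits its spectrum. -/
theorem adjMatrix_liftGraph_mulVec (ε : Sym2 V → Bool) (z : V × Bool → ℝ) (p : V × Bool) :
    ((liftGraph G ε).adjMatrix ℝ *ᵥ z) p =
      ((G.adjMatrix ℝ *ᵥ fun i => z (i, true) + z (i, false)) p.1 +
        boolSign p.2 *
          (signedAdjMatrix G ε *ᵥ fun i => z (i, true) - z (i, false)) p.1) / 2 := by
  simp only [mulVec, dotProduct, adjMatrix_liftGraph_apply, Fintype.sum_prod_type, Fintype.sum_bool,
    Finset.mul_sum, ← Finset.sum_add_distrib, Finset.sum_div]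
  refine Finset.sum_congr rfl fun i _ => ?_
  simp only [boolSign, if_true, Bool.false_eq_true, if_false]
  ring

theorem isRegularOfDegree_liftGraph {d : ℕ} (hreg : G.IsRegularOfDegree d) (ε : Sym2 V → Bool) :
    (liftGraph G ε).IsRegularOfDegree d := by
  intro p
  have h1 := adjMatrix_liftGraph_mulVec G ε (Function.const _ 1) p
  rw [SimpleGraph.adjMatrix_mulVec_const_apply] at h1
  have h2 := SimpleGraph.adjMatrix_mulVec_const_apply_of_regular (α := ℝ) (a := 2) hreg (v := p.1)
  have h3 : (fun i : V => Function.const (V × Bool) (1 : ℝ) (i, true) +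
      Function.const (V × Bool) (1 : ℝ) (i, false)) = Function.const V 2 := by
    ext i; norm_num
  have h4 : (fun i : V => Function.const (V × Bool) (1 : ℝ) (i, true) -
      Function.const (V × Bool) (1 : ℝ) (i, false)) = 0 := by
    ext i; simp
  rw [h3, h4, h2, mulVec_zero] at h1
  have h5 : ((liftGraph G ε).degree p : ℝ) = d := by simpa using h1
  exact_mod_cast h5

theorem dotProduct_adjMatrix_liftGraph (ε : Sym2 V → Bool) (z : V × Bool → ℝ) :
    z ⬝ᵥ (liftGraph G ε).adjMatrix ℝ *ᵥ z =
      ((fun i => z (i, true) + z (i, false)) ⬝ᵥ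
          G.adjMatrix ℝ *ᵥ fun i => z (i, true) + z (i, false)) / 2 +
        ((fun i => z (i, true) - z (i, false)) ⬝ᵥ
          signedAdjMatrix G ε *ᵥ fun i => z (i, true) - z (i, false)) / 2 := by
  simp only [dotProduct, adjMatrix_liftGraph_mulVec, Fintype.sum_prod_type, Fintype.sum_bool,
    ← Finset.sum_add_distrib, Finset.sum_div]
  refine Finset.sum_congr rfl fun i _ => ?_
  simp only [boolSign, if_true, Bool.false_eq_true, if_false]
  ring

theorem dotProduct_adjMatrix_liftGraph_le {ε : Sym2 V → Bool} {lam : ℝ}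
    (hform : ∀ f : V → ℝ, ∑ i, f i = 0 → f ⬝ᵥ G.adjMatrix ℝ *ᵥ f ≤ lam * (f ⬝ᵥ f))
    (hε : ∀ f : V → ℝ, f ⬝ᵥ signedAdjMatrix G ε *ᵥ f ≤ lam * (f ⬝ᵥ f))
    (z : V × Bool → ℝ) (hz : ∑ p, z p = 0) :
    z ⬝ᵥ (liftGraph G ε).adjMatrix ℝ *ᵥ z ≤ lam * (z ⬝ᵥ z) := by
  rw [Fintype.sum_prod_type] at hz
  simp only [Fintype.sum_bool] at hz
  have h1 := hform _ hz
  have h2 := hε fun i => z (i, true) - z (i, false)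
  have h3 : z ⬝ᵥ z = ((fun i => z (i, true) + z (i, false)) ⬝ᵥ
        fun i => z (i, true) + z (i, false)) / 2 +
      ((fun i => z (i, true) - z (i, false)) ⬝ᵥ fun i => z (i, true) - z (i, false)) / 2 := by
    simp only [dotProduct, Fintype.sum_prod_type, Fintype.sum_bool,
      ← Finset.sum_add_distrib, Finset.sum_div]
    refine Finset.sum_congr rfl fun i _ => ?_
    ring
  rw [dotProduct_adjMatrix_liftGraph, h3]
  linarith

/-- Eigenvectors pull back to vectors constant on the fibres. -/
theorem eigenvalueMultiplicity_le_liftGraph [DecidableEq V] (ε : Sym2 V → Bool) (lam : ℝ) :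
    eigenvalueMultiplicity G lam ≤ eigenvalueMultiplicity (liftGraph G ε) lam := by
  let φ : (V → ℝ) →ₗ[ℝ] (V × Bool → ℝ) := LinearMap.funLeft ℝ ℝ Prod.fst
  have hφ : Function.Injective φ :=
    LinearMap.funLeft_injective_of_surjective _ _ _ Prod.fst_surjective
  have hle : (Module.End.eigenspace (toLin' (G.adjMatrix ℝ)) lam).map φ ≤
      Module.End.eigenspace (toLin' ((liftGraph G ε).adjMatrix ℝ)) lam := by
    rintro _ ⟨f, hf, rfl⟩
    have hf' : G.adjMatrix ℝ *ᵥ f = lam • f := by simpa using Module.End.mem_eigenspace_iff.1 hf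
    rw [Module.End.mem_eigenspace_iff, toLin'_apply]
    ext p
    rw [adjMatrix_liftGraph_mulVec]
    have h1 : (fun i => φ f (i, true) + φ f (i, false)) = (2 : ℝ) • f := by
      ext i; simp [φ, LinearMap.funLeft_apply]; ring
    have h2 : (fun i => φ f (i, true) - φ f (i, false)) = 0 := by
      ext i; simp [φ, LinearMap.funLeft_apply]
    rw [h1, h2, mulVec_smul, hf', mulVec_zero]
    simp [φ, LinearMap.funLeft_apply]
  rw [eigenvalueMultiplicity, eigenvalueMultiplicity,
    (Submodule.equivMapOfInjective φ hφ
      (Module.End.eigenspace (toLin' (G.adjMatrix ℝ)) lam)).finrank_eq]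
  exact Submodule.finrank_mono hle

end

/-- Induction on a bound `r` for the number of vertices missing. A lift may be disconnected and may
have a larger multiplicity, so connectedness is replaced by `hform` and `lam < d`, and `k` is only a
lower bound. -/
theorem add_le_maxEquiangularLines {d k m : ℕ} {lam α : ℝ} (hpos : 0 < lam)
    (hα : α = 1 / (2 * lam + 1)) (hd : lam < d) (h2 : 2 ≤ d)
    (hsqrt : 2 * √((d : ℝ) - 1) ≤ lam) (hthird : 2 * (d : ℝ) / 3 ≤ lam) (r : ℕ)
    {V : Type*} [Fintype V] [DecidableEq V] (G : SimpleGraph V) [DecidableRel G.Adj]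
    (hreg : G.IsRegularOfDegree d)
    (hform : ∀ f : V → ℝ, ∑ i, f i = 0 → f ⬝ᵥ G.adjMatrix ℝ *ᵥ f ≤ lam * (f ⬝ᵥ f))
    (hk : k ≤ eigenvalueMultiplicity G lam) (hnd : 2 * d ≤ Fintype.card V)
    (hm : Fintype.card V ≤ m + k) (hr : m + k ≤ r + Fintype.card V) :
    ((m + k : ℕ) : ℕ∞) ≤ maxEquiangularLines α m := by
  induction r generalizing V with
  | zero =>
    have hne : Nonempty V := Fintype.card_pos_iff.1 (by omega)
    have := card_add_le_maxEquiangularLines G hreg hpos hα hform hnd (Or.inl rfl) hd (m := m)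
      (by omega)
    rwa [show m + k = Fintype.card V + 0 by omega]
  | succ r ih =>
    have hne : Nonempty V := Fintype.card_pos_iff.1 (by omega)
    by_cases hle : m + k ≤ 2 * Fintype.card V
    · have := card_add_le_maxEquiangularLines G hreg hpos hα hform hnd
        (t := m + k - Fintype.card V) (Or.inr ⟨by omega, hthird⟩) hd (m := m) (by omega)
      rwa [Nat.add_sub_cancel' hm] at this
    · obtain ⟨ε, hε⟩ := exists_signedAdjMatrix_le G h2 hreg
      have hε' : ∀ f : V → ℝ, f ⬝ᵥ signedAdjMatrix G ε *ᵥ f ≤ lam * (f ⬝ᵥ f) := fun f =>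
        (hε f).trans (mul_le_mul_of_nonneg_right hsqrt
          (Finset.sum_nonneg fun i _ => mul_self_nonneg _))
      have hcard : Fintype.card (V × Bool) = 2 * Fintype.card V := by
        rw [Fintype.card_prod, Fintype.card_bool, mul_comm]
      exact ih (liftGraph G ε) (isRegularOfDegree_liftGraph G hreg ε)
        (dotProduct_adjMatrix_liftGraph_le G hform hε')
        (hk.trans (eigenvalueMultiplicity_le_liftGraph G ε lam)) (by omega) (by omega) (by omega)

/-! ### The second eigenvalue of a connected regular graph -/

theorem exists_eigenvector_of_isSecondEigenvalue {V : Type*} [Fintype V] [DecidableEq V]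
    {G : SimpleGraph V} [DecidableRel G.Adj] {lam : ℝ} (hlam : IsSecondEigenvalue G lam) :
    ∃ f : V → ℝ, f ≠ 0 ∧ G.adjMatrix ℝ *ᵥ f = lam • f := by
  obtain ⟨hV, hlam⟩ := hlam
  set hA := G.isHermitian_adjMatrix ℝ
  let i : V := Fintype.equivOfCardEq (Fintype.card_fin _) (⟨1, hV⟩ : Fin (Fintype.card V))
  refine ⟨hA.eigenvectorBasis i, fun h => hA.eigenvectorBasis.orthonormal.ne_zero i ?_, ?_⟩
  · ext j
    simpa using congrFun h j
  · rw [hA.mulVec_eigenvectorBasis, ← hlam]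
    simp [IsHermitian.eigenvalues, i]

/-- Crossing an edge of a perfect matching multiplies `f` by `λ`, and crossing back returns to the
start. This will exclude `d = 1`, where `0 < λ < 1`. -/
theorem sq_eq_one_of_isRegularOfDegree_one {V : Type*} [Fintype V] {G : SimpleGraph V}
    [DecidableRel G.Adj] (hreg : G.IsRegularOfDegree 1) {lam : ℝ} {f : V → ℝ} (hf : f ≠ 0)
    (hAf : G.adjMatrix ℝ *ᵥ f = lam • f) : lam ^ 2 = 1 := by
  have key : ∀ u v, G.Adj u v → f v = lam * f u := by
    intro u v huv
    obtain ⟨w, hw⟩ := Finset.card_eq_one.1 (hreg u)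
    have hv : v = w := by
      rw [← Finset.mem_singleton, ← hw]
      simpa using huv
    have h := congrFun hAf u
    rw [SimpleGraph.adjMatrix_mulVec_apply, hw, Finset.sum_singleton, ← hv] at h
    simpa using h
  obtain ⟨u, hu⟩ := Function.ne_iff.1 hf
  obtain ⟨v, hv⟩ := Finset.card_eq_one.1 (hreg u)
  have huv : G.Adj u v := by
    rw [← SimpleGraph.mem_neighborFinset, hv, Finset.mem_singleton]
  have h := key v u huv.symm
  rw [key u v huv] at h
  refine mul_right_cancel₀ hu ?_
  linarith

/-- The second eigenvalue of a connected `d`-regular graph is less than `d`, and it bounds the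
quadratic form of the adjacency matrix on the vectors orthogonal to the constants. -/
theorem lt_degree_and_dotProduct_le_of_isSecondEigenvalue {V : Type*} [Fintype V] [DecidableEq V]
    (G : SimpleGraph V) [DecidableRel G.Adj] {d : ℕ} {lam : ℝ} (hconn : G.Connected)
    (hreg : G.IsRegularOfDegree d) (hlam : IsSecondEigenvalue G lam) :
    lam < d ∧ ∀ f : V → ℝ, ∑ i, f i = 0 → f ⬝ᵥ G.adjMatrix ℝ *ᵥ f ≤ lam * (f ⬝ᵥ f) := by
  obtain ⟨hV, hlam⟩ := hlam
  set hA := G.isHermitian_adjMatrix ℝ with hA'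
  let e : Fin (Fintype.card V) ≃ V := Fintype.equivOfCardEq (Fintype.card_fin _)
  have hev : ∀ i, hA.eigenvalues (e i) = hA.eigenvalues₀ i := fun i => by
    simp [IsHermitian.eigenvalues, e]
  set i₀ := e ⟨0, by omega⟩ with hi₀
  set i₁ := e ⟨1, hV⟩ with hi₁
  have hi01 : i₀ ≠ i₁ := fun h => by simpa using e.injective h
  have hlam₁ : hA.eigenvalues i₁ = lam := by rw [hev, hlam]
  have hlam₀ : lam ≤ hA.eigenvalues i₀ := by
    rw [hev, ← hlam]
    exact hA.eigenvalues₀_antitone (by simp [Fin.le_def])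
  have hle : ∀ l, l ≠ i₀ → hA.eigenvalues l ≤ lam := by
    intro l hl
    obtain ⟨j, rfl⟩ := e.surjective l
    rw [hev, ← hlam]
    refine hA.eigenvalues₀_antitone ?_
    have : j ≠ ⟨0, by omega⟩ := fun h => hl (by rw [h])
    rw [Fin.le_def]
    have : j.val ≠ 0 := fun h => this (Fin.ext h)
    simp only
    omega
  have hlap : ∀ x : V → ℝ, G.lapMatrix ℝ *ᵥ x = (d : ℝ) • x - G.adjMatrix ℝ *ᵥ x := by
    intro x
    ext i
    simp [SimpleGraph.lapMatrix_mulVec_apply, hreg.degree_eq i]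
  have hconst : ∀ l, hA.eigenvalues l = d → ∀ i j, hA.eigenvectorBasis l i =
      hA.eigenvectorBasis l j := by
    intro l hl i j
    refine (G.lapMatrix_mulVec_eq_zero_iff_forall_reachable).1 ?_ i j (hconn.preconnected i j)
    rw [hlap, hA.mulVec_eigenvectorBasis, hl, sub_self]
  have hsumne : ∀ l, hA.eigenvalues l = d → ∑ i, hA.eigenvectorBasis l i ≠ 0 := by
    intro l hl h0
    refine hA.eigenvectorBasis.orthonormal.ne_zero l ?_
    ext i
    rw [Finset.sum_congr rfl fun j _ => hconst l hl j i] at h0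
    rw [Finset.sum_const, Finset.card_univ, smul_eq_zero] at h0
    exact h0.resolve_left (by omega)
  have heq : ∀ l, ∑ i, hA.eigenvectorBasis l i ≠ 0 → hA.eigenvalues l = d := by
    intro l hl
    have h := sum_adjMatrix_mulVec G hreg (hA.eigenvectorBasis l)
    rw [hA.mulVec_eigenvectorBasis] at h
    simp only [Pi.smul_apply, smul_eq_mul, ← Finset.mul_sum] at h
    exact mul_right_cancel₀ hl h
  have hinner : ∀ l l', hA.eigenvalues l' = d → l ≠ l' → ∑ i, hA.eigenvectorBasis l i = 0 := by
    intro l l' hl' hne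
    have h : inner ℝ (hA.eigenvectorBasis l) (hA.eigenvectorBasis l') = 0 :=
      hA.eigenvectorBasis.orthonormal.2 hne
    obtain ⟨i⟩ : Nonempty V := ⟨i₀⟩
    rw [PiLp.inner_apply] at h
    have h' : hA.eigenvectorBasis l' i * ∑ j, hA.eigenvectorBasis l j = 0 := by
      rw [Finset.mul_sum, ← h]
      refine Finset.sum_congr rfl fun j _ => ?_
      rw [hconst l' hl' i j]
      simp
    refine (mul_eq_zero.1 h').resolve_left fun h0 => hsumne l' hl' ?_
    rw [Finset.sum_congr rfl fun j _ => (hconst l' hl' j i).trans h0]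
    simp
  have hmax : ∀ l, hA.eigenvalues l ≤ d := by
    intro l
    have h := (SimpleGraph.posSemidef_lapMatrix ℝ G).dotProduct_mulVec_nonneg
      (hA.eigenvectorBasis l)
    rw [hlap, hA.mulVec_eigenvectorBasis, ← sub_smul, dotProduct_smul, smul_eq_mul,
      star_trivial] at h
    have h1 : (hA.eigenvectorBasis l : V → ℝ) ⬝ᵥ hA.eigenvectorBasis l = 1 := by
      have h2 := hA.eigenvectorBasis.orthonormal.1 l
      have h3 := real_inner_self_eq_norm_sq (hA.eigenvectorBasis l)
      rw [h2, PiLp.inner_apply] at h3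
      simpa [dotProduct, sq] using h3
    rw [h1] at h
    linarith
  -- Eigenvectors for `d` are constant, as they lie in the kernel of the Laplacian of a connected
  -- graph; two of them cannot be orthogonal.
  have hlt : lam < d := by
    by_contra! hc
    have h1 : hA.eigenvalues i₁ = d := le_antisymm (hmax _) (by linarith)
    have h0 : hA.eigenvalues i₀ = d := le_antisymm (hmax _) (by linarith)
    exact hsumne i₁ h1 (hinner i₁ i₀ h0 hi01.symm)
  -- Otherwise every basis eigenvector has sum zero, and the all-ones vector is orthogonal to a
  -- basis.
  have h₀ : hA.eigenvalues i₀ = d := by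
    by_contra hc
    have hzero : ∀ l, ∑ i, hA.eigenvectorBasis l i = 0 := by
      intro l
      by_contra hl
      have h1 := heq l hl
      rcases eq_or_ne l i₀ with rfl | hne
      · exact hc h1
      · have := hle l hne
        linarith
    have hone : (WithLp.toLp 2 1 : EuclideanSpace ℝ V) = 0 := by
      refine InnerProductSpace.ext_inner_left_basis hA.eigenvectorBasis.toBasis fun l => ?_
      rw [OrthonormalBasis.coe_toBasis, inner_zero_right, PiLp.inner_apply]
      simpa using hzero l
    have := congrArg (fun x : EuclideanSpace ℝ V => x i₀) hone
    simp at this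
  refine ⟨hlt, fun f hf => ?_⟩
  set F : EuclideanSpace ℝ V := WithLp.toLp 2 f with hF
  have hcoef : ∀ l, inner ℝ (hA.eigenvectorBasis l) F = ∑ i, hA.eigenvectorBasis l i * f i := by
    intro l
    rw [PiLp.inner_apply]
    simp [hF, mul_comm]
  have hff : f ⬝ᵥ f = ∑ l, (∑ i, hA.eigenvectorBasis l i * f i) ^ 2 := by
    simp only [← hcoef]
    rw [hA.eigenvectorBasis.sum_sq_inner_right, EuclideanSpace.real_norm_sq_eq]
    simp [hF, dotProduct, sq]
  have hfAf : f ⬝ᵥ G.adjMatrix ℝ *ᵥ f =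
      ∑ l, hA.eigenvalues l * (∑ i, hA.eigenvectorBasis l i * f i) ^ 2 := by
    simp only [dotProduct, mulVec, hA.apply_eq_sum, sq, Finset.sum_mul, Finset.mul_sum]
    rw [Finset.sum_congr rfl fun i _ => Finset.sum_comm, Finset.sum_comm]
    refine Finset.sum_congr rfl fun l _ => Finset.sum_congr rfl fun i _ =>
      Finset.sum_congr rfl fun j _ => ?_
    ring
  rw [hff, hfAf, Finset.mul_sum]
  refine Finset.sum_le_sum fun l _ => ?_
  rcases eq_or_ne l i₀ with rfl | hne
  · have : ∑ i, hA.eigenvectorBasis i₀ i * f i = 0 := by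
      rw [Finset.sum_congr rfl fun i _ => by rw [hconst i₀ h₀ i i₀], ← Finset.mul_sum, hf, mul_zero]
    simp [this]
  · exact mul_le_mul_of_nonneg_right (hle l hne) (sq_nonneg _)

end

theorem lemma6p4 {V : Type*} [Fintype V] [DecidableEq V] (G : SimpleGraph V) [DecidableRel G.Adj]
    (n d k : ℕ) (lam α : ℝ) (hn : Fintype.card V = n) (hconn : G.Connected)
    (hreg : G.IsRegularOfDegree d) (hlam : IsSecondEigenvalue G lam) (hpos : 0 < lam)
    (hk : eigenvalueMultiplicity G lam = k) (hα : α = 1 / (2 * lam + 1)) (hnd : 2 * d ≤ n) :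
    (n : ℕ∞) ≤ maxEquiangularLines α (n - k) ∧
      (2 * Real.sqrt ((d : ℝ) - 1) ≤ lam → 2 * (d : ℝ) / 3 ≤ lam →
        ∀ m : ℕ, n - k ≤ m → ((m + k : ℕ) : ℕ∞) ≤ maxEquiangularLines α m) := by
  subst hn hk
  obtain ⟨hd, hform⟩ := lt_degree_and_dotProduct_le_of_isSecondEigenvalue G hconn hreg hlam
  have hne : Nonempty V := hconn.nonempty
  constructor
  · exact card_add_le_maxEquiangularLines G hreg hpos hα hform hnd (t := 0) (Or.inl rfl) hd
      (by omega)
  · intro hsqrt hthird m hm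
    have h2 : 2 ≤ d := by
      have h1 : (0 : ℝ) < d := hpos.trans hd
      have h1' : 0 < d := by exact_mod_cast h1
      by_contra hc
      obtain rfl : d = 1 := by omega
      obtain ⟨f, hf, hAf⟩ := exists_eigenvector_of_isSecondEigenvalue hlam
      have := sq_eq_one_of_isRegularOfDegree_one hreg hf hAf
      push_cast at hd
      nlinarith
    -- The induction bound `r` is taken to be `m + k`, which is amply large.
    exact add_le_maxEquiangularLines hpos hα hd h2 hsqrt hthird _ G hreg hform le_rfl hnd
      (by omega) (Nat.le_add_right _ _)
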